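/- Partitions are identified with Young diagrams; $\ell(\nu)$ is the number of non-zero parts of $\nu$, $\nu'$ the conjugate, sums of partitions are taken part by part, and $(k,j)$ is the box in row $k$ and column $j$. For a partition $\mu\subseteq(m^m)$ let $\mu^c$ be its complement in $(m^m)$, i.e. $(m^m)/\mu$ rotated by $180^\circ$. A symmetric function is Schur-positive if it is a linear combination of Schur functions with non-negative integer coefficients. If complements are taken in $(m^m)$, we say that $\mu$ covers $\nu$ if $\nu\subseteq\mu\subseteq (m^m)$, $|\mu|=|\nu|+1$ and $s_{\mu'}s_{\mu^c}-s_{\nu'}s_{\nu^c}$ is Schur-positive. Throughout, complements are taken in any square $(m^m)$ with $m\ge\mu_1+\ell(\mu)$. A partition $\nu$ is of type 2 if $\nu=\beta+(s^s)+\alpha$, where $s\ge 1$, $\beta$ and $\alpha$ are partitions, $\alpha\ne\emptyset$, $\ell(\alpha)\le s$, and, with $i=\beta_1\geq 0$, $\beta$ contains the partition $(i^{s+1},i,i-1,i-2,\dots,1)$. A partition $\nu$ is corner-symmetric if for every outer corner $(k,j)$ of $\nu$ with $k>1$ (a position outside the diagram such that adding a box there gives a Young diagram) there is a non-empty partition $\eta\subseteq\nu$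 such that $\nu/\eta$ is, up to translation, the diagram of a self-conjugate partition, contains the box $(k-1,j)$, and contains no box from the first $j-1$ columns of $\nu$. Proposition. Let $\nu=\beta+(s^s)+\alpha$ be of type 2 (with $\beta,s,\alpha$ as above), and suppose that the partition $\nu_{(s)}$ obtained from $\nu$ by removing its first $s$ rows is corner-symmetric. Then $\nu$ is not covered by any partition $\mu$ with $\nu\subseteq\mu$, $|\mu|=|\nu|+1$ and $\mu\neq\beta+(s^s,1)+\alpha$. In particular, if $\nu=\beta+(s^s)+\alpha$ is of type 2 with $\beta_1=1$, then $\nu$ is not covered by any such $\mu$. -/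

import Mathlib

/-! Partitions are Mathlib's Young diagrams, in matrix coordinates with rows and columns counted
from `0`: `ν.rowLen r` is the part `ν_{r+1}`, `ν.colLen 0` is the length `ℓ(ν)`, `ν.card` is `|ν|`,
`ν.transpose` is the conjugate, `≤` is containment of diagrams and `⊥` is the empty partition. -/

namespace SchurCover

/-- The partition with parts `f 0 ≥ f 1 ≥ f 2 ≥ ⋯`, where `f n = 0`. -/
def ofRows (f : ℕ → ℕ) (hf : Antitone f) (n : ℕ) (_hn : f n = 0) :
    YoungDiagram where
  cells := (Finset.range n ×ˢ Finset.range (f 0)).filter fun c => c.2 < f c.1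
  isLowerSet := by
    intro a b hba ha
    simp only [Finset.coe_filter, Finset.mem_product, Finset.mem_range, Set.mem_ofPred_eq] at ha ⊢
    have h1 : b.1 ≤ a.1 := hba.1
    have h2 : b.2 ≤ a.2 := hba.2
    have h3 := hf h1
    exact ⟨⟨by omega, by omega⟩, by omega⟩

theorem mem_ofRows {f : ℕ → ℕ} {hf : Antitone f} {n : ℕ} {hn : f n = 0} {c : ℕ × ℕ} :
    c ∈ ofRows f hf n hn ↔ c.2 < f c.1 := by
  rw [← YoungDiagram.mem_cells]
  simp only [ofRows, Finset.mem_filter, Finset.mem_product, Finset.mem_range, and_iff_right_iff_imp]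
  intro h
  refine ⟨?_, lt_of_lt_of_le h (hf (Nat.zero_le _))⟩
  by_contra hc
  have := hf (not_lt.mp hc)
  omega

theorem rowLen_ofRows {f : ℕ → ℕ} {hf : Antitone f} {n : ℕ} {hn : f n = 0} (r : ℕ) :
    (ofRows f hf n hn).rowLen r = f r := by
  refine eq_of_forall_lt_iff fun j => ?_
  rw [← YoungDiagram.mem_iff_lt_rowLen, mem_ofRows]

theorem antitone_rowLen (ν : YoungDiagram) : Antitone ν.rowLen :=
  fun a b h => ν.rowLen_anti a b h

theorem rowLen_eq_zero (ν : YoungDiagram) {r : ℕ} (h : ν.colLen 0 ≤ r) : ν.rowLen r = 0 := by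
  by_contra h0
  have h1 : (r, 0) ∈ ν := YoungDiagram.mem_iff_lt_rowLen.mpr (Nat.pos_of_ne_zero h0)
  have := YoungDiagram.mem_iff_lt_colLen.mp h1
  omega

/-- The sum of two partitions: parts are added, `(β + α)_r = β_r + α_r`. -/
instance instAddYoungDiagram : Add YoungDiagram where
  add β α := ofRows (fun r => β.rowLen r + α.rowLen r)
    (fun _ _ h => Nat.add_le_add (antitone_rowLen β h) (antitone_rowLen α h))
    (max (β.colLen 0) (α.colLen 0))
    (by simp [rowLen_eq_zero β (le_max_left _ _), rowLen_eq_zero α (le_max_right _ _)])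

theorem rowLen_add (β α : YoungDiagram) (r : ℕ) :
    (β + α).rowLen r = β.rowLen r + α.rowLen r := rowLen_ofRows r

/-- The square partition `(s^s)`. -/
def square (s : ℕ) : YoungDiagram :=
  ofRows (fun r => if r < s then s else 0)
    (by intro a b h; dsimp only; split_ifs <;> omega) s (by simp)

/-- The partition `(s^s, 1)`. -/
def squareOne (s : ℕ) : YoungDiagram :=
  ofRows (fun r => if r < s then s else if r = s then 1 else 0)
    (by intro a b h; dsimp only; split_ifs <;> omega) (s + 1) (by simp)

/-- The partition `(i^{s+1}, i, i-1, i-2, …, 1)`: the first `s + 1` rows have length `i`, and row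
number `s + 1 + t` (counted from `0`) has length `i - t` (truncated subtraction). -/
def fatStaircase (i s : ℕ) : YoungDiagram :=
  ofRows (fun r => i - (r - (s + 1))) (by intro a b h; dsimp only; omega) (s + 1 + i) (by omega)

/-- `β + (s^s) + α` is an expression of a partition of type 2. -/
structure IsTypeTwo (β : YoungDiagram) (s : ℕ) (α : YoungDiagram) : Prop where
  one_le : 1 ≤ s
  ne_bot : α ≠ ⊥
  length_le : α.colLen 0 ≤ s
  contains : fatStaircase (β.rowLen 0) s ≤ β

/-- `ν_{(s)}`: the partition `ν` with its first `s` rows removed. -/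
def dropRows (s : ℕ) (ν : YoungDiagram) : YoungDiagram :=
  ofRows (fun r => ν.rowLen (r + s)) (fun _ _ h => antitone_rowLen ν (Nat.add_le_add_right h s))
    (ν.colLen 0) (rowLen_eq_zero ν (Nat.le_add_right _ _))

/-- The complement of `μ` in the square `(m^m)`: the cells of the square outside `μ`, rotated by
180 degrees. -/
def complement (m : ℕ) (μ : YoungDiagram) : YoungDiagram where
  cells := (Finset.range m ×ˢ Finset.range m).filter fun c => (m - 1 - c.1, m - 1 - c.2) ∉ μ
  isLowerSet := by
    intro a b hba ha
    simp only [Finset.coe_filter, Finset.mem_product, Finset.mem_range, Set.mem_ofPred_eq] at ha ⊢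
    have h1 : b.1 ≤ a.1 := hba.1
    have h2 : b.2 ≤ a.2 := hba.2
    refine ⟨⟨by omega, by omega⟩, fun h => ha.2 ?_⟩
    exact μ.up_left_mem (by omega) (by omega) h

/-- A position outside the diagram whose addition to the diagram gives a Young diagram. -/
def IsOuterCorner (ν : YoungDiagram) (c : ℕ × ℕ) : Prop :=
  c ∉ ν ∧ IsLowerSet (insert c (ν.cells : Set (ℕ × ℕ)))

/-- The skew shape `ν / η` is, up to its position in the plane, the diagram of a self-conjugate
partition `ρ` (so it is a straight shape). -/
def IsSelfConjugateShape (ν η : YoungDiagram) : Prop :=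
  ∃ (ρ : YoungDiagram) (a b : ℕ), ρ.transpose = ρ ∧
    ν.cells \ η.cells = ρ.cells.image fun c => (c.1 + a, c.2 + b)

/-- Corner-symmetric partitions. With rows and columns counted from `0`, the outer corners not in
the first row are those with `0 < k`, the box above `(k, j)` is `(k - 1, j)`, and the columns to the
left of it are those with index less than `j`. -/
def CornerSymmetric (ν : YoungDiagram) : Prop :=
  ∀ k j : ℕ, 0 < k → IsOuterCorner ν (k, j) →
    ∃ η : YoungDiagram, η ≠ ⊥ ∧ η ≤ ν ∧ IsSelfConjugateShape ν η ∧
      (k - 1, j) ∈ ν.cells \ η.cells ∧ ∀ c ∈ ν.cells \ η.cells, j ≤ c.2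

/-- The type (content) of a semistandard tableau: how often each label occurs. Labels and variables
are indexed by `0, 1, 2, …`. -/
noncomputable def content {sh : YoungDiagram} (T : SemistandardYoungTableau sh) : ℕ →₀ ℕ :=
  ∑ c ∈ sh.cells, Finsupp.single (T c.1 c.2) 1

/-- The Schur function `s_λ = ∑_T w(T)` in the variables `x_0, x_1, …`, the sum being over all
semistandard tableaux `T` of shape `λ`: the coefficient of a monomial is the (finite) number of
tableaux with that content. -/
noncomputable def schur (sh : YoungDiagram) : MvPowerSeries ℕ ℤ :=
  fun d => (Nat.card {T : SemistandardYoungTableau sh // content T = d} : ℤ)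

/-- `f` is a linear combination of Schur functions with non-negative integer coefficients. -/
def SchurPositive (f : MvPowerSeries ℕ ℤ) : Prop :=
  ∃ c : YoungDiagram →₀ ℕ, f = ∑ sh ∈ c.support, c sh • schur sh

/-- `μ` covers `ν`, with complements taken in the square `(m^m)`. -/
structure Covers (m : ℕ) (μ ν : YoungDiagram) : Prop where
  le : ν ≤ μ
  card_eq : μ.card = ν.card + 1
  le_square : μ ≤ square m
  schurPositive : SchurPositive
    (schur μ.transpose * schur (complement m μ) - schur ν.transpose * schur (complement m ν))

end SchurCover

/-!
Suppose that `μ` is obtained from `ν = β + (s^s) + α` by adding a cell that is not in row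
`s + 1`. It suffices to find a partition `λ` such that `s_λ` occurs in `s_{ν'} s_{ν^c}` but not
in `s_{μ'} s_{μ^c}`.

Restricting to `m` variables, the multiplicity of `s_λ` in a symmetric polynomial `f` is the
coefficient of `x^{λ+δ}` in `a_δ f`, where `a_δ` is the Vandermonde alternant. For `f = s_A s_B` it is
the number of semistandard tableaux `T` of shape `B` such that `A` plus the content of the columns
`≥ j` of `T` is a partition for every `j`, and is `λ` for `j = 0` (`coeff_alternate_mul_schurPoly`).
This is the Littlewood–Richardson rule, proved by Stembridge's argument: the alternants of the other
tableaux cancel in pairs under a Bender–Knuth involution applied to the columns left of the first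
failure from the right (`sum_not_compatible`). The Bender–Knuth involution is written as a toggle: the row lengths of
the subtableau of labels `≤ i` are reflected in the intervals that the labels `< i` and `≤ i + 1`
leave to them (`toggle`, `benderKnuth`).

The partition `λ` is the square `(m^m)` with `η` cut out of its lower right corner and `η'` attached
on its right, for some `η ⊆ ν` (`targetRow`). As `m ≥ μ_1 + ℓ(μ)`, the labels `< m - ℓ(μ)` of a
contributing tableau of shape `μ'` have to fill `η'` (`Contributes.label_lt_iff`), and the other labels
form a tableau of shape `μ' / η'` in which the label `m - 1 - r` occurs `μ_r - η_r` times.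

If `ν / η` consists of the rows of a self-conjugate partition, possibly shifted apart, such a tableau
exists for `ν` (`contributes_tableau`). There are two cases for the added cell.

* It lies in the first `s` rows: take `η = β + α`, so that the rows of the square `(s^s)` are added to
  `η`. Then `μ' / η'` lies in `s` columns while some label has to occur `s + 1` times
  (`Contributes.rowLen_le_add`).
* It lies below row `s + 1`: take the `η` provided by corner-symmetry. Then `μ / η` is a self-conjugate
  shape with one cell added below its first column; were there a contributing tableau, this shape would
  have to equal its own conjugate (`Contributes.not_cell_below` derives the contradiction from the
  first column).

If `β_1 = 1`, the partition without its first `s` rows is a single column of length at least two, which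
is corner-symmetric.
-/

namespace SchurCover

open Finset

/-! ### Labels of semistandard tableaux -/

/-- The number of cells in the columns `≥ j` that carry the label `p`. -/
def labelCount {B : YoungDiagram} (T : SemistandardYoungTableau B) (j p : ℕ) : ℕ :=
  #{c ∈ B.cells | j ≤ c.2 ∧ T c.1 c.2 = p}

/-- The cells in the columns `< j` with labels `< p`. -/
def labelsBelow {B : YoungDiagram} (T : SemistandardYoungTableau B) (j p : ℕ) : YoungDiagram where
  cells := {c ∈ B.cells | c.2 < j ∧ T c.1 c.2 < p}
  isLowerSet := by
    intro a b hba ha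
    simp only [coe_filter, Set.mem_ofPred_eq, YoungDiagram.mem_cells] at ha ⊢
    have h1 : b.1 ≤ a.1 := hba.1
    have h2 : b.2 ≤ a.2 := hba.2
    have hab : (b.1, a.2) ∈ B := B.up_left_mem h1 le_rfl ha.1
    refine ⟨B.up_left_mem h1 h2 ha.1, lt_of_le_of_lt h2 ha.2.1, ?_⟩
    exact lt_of_le_of_lt ((T.row_weak_of_le h2 hab).trans (T.col_weak h1 ha.1)) ha.2.2

/-! ### The Bender–Knuth involution on an initial set of columns -/

section BenderKnuth

variable {B : YoungDiagram} (T : SemistandardYoungTableau B)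

theorem lt_rowLen_labelsBelow {j p r c : ℕ} :
    c < (labelsBelow T j p).rowLen r ↔ (r, c) ∈ B ∧ c < j ∧ T r c < p := by
  rw [← YoungDiagram.mem_iff_lt_rowLen, ← YoungDiagram.mem_cells]
  simp [labelsBelow]

theorem rowLen_labelsBelow_mono {j p q : ℕ} (h : p ≤ q) (r : ℕ) :
    (labelsBelow T j p).rowLen r ≤ (labelsBelow T j q).rowLen r := by
  refine le_of_forall_lt fun c hc => ?_
  rw [lt_rowLen_labelsBelow] at hc ⊢
  exact ⟨hc.1, hc.2.1, hc.2.2.trans_le h⟩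

/-- Column strictness: the labels below `p + 1` exceed the labels below `p` by a horizontal strip. -/
theorem rowLen_labelsBelow_succ_le (j p r : ℕ) :
    (labelsBelow T j (p + 1)).rowLen (r + 1) ≤ (labelsBelow T j p).rowLen r := by
  refine le_of_forall_lt fun c hc => ?_
  rw [lt_rowLen_labelsBelow] at hc ⊢
  have h := T.col_strict (Nat.lt_add_one r) hc.1
  exact ⟨B.up_left_mem (Nat.le_succ r) le_rfl hc.1, hc.2.1, by omega⟩

/-- The largest value that row `r` of the labels `≤ i` can take, the labels `< i` and the labels
`≤ i + 1` being fixed. -/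
def toggleUpper (j i r : ℕ) : ℕ :=
  if r = 0 then (labelsBelow T j (i + 2)).rowLen 0
  else min ((labelsBelow T j i).rowLen (r - 1)) ((labelsBelow T j (i + 2)).rowLen r)

/-- The smallest value that row `r` of the labels `≤ i` can take, the labels `< i` and the labels
`≤ i + 1` being fixed. -/
def toggleLower (j i r : ℕ) : ℕ :=
  max ((labelsBelow T j i).rowLen r) ((labelsBelow T j (i + 2)).rowLen (r + 1))

/-- The reflection of row `r` of the labels `≤ i` in the interval of its possible values. -/
def toggle (j i r : ℕ) : ℕ :=
  toggleUpper T j i r + toggleLower T j i r - (labelsBelow T j (i + 1)).rowLen r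

theorem toggleLower_le (j i r : ℕ) :
    toggleLower T j i r ≤ (labelsBelow T j (i + 1)).rowLen r :=
  max_le (rowLen_labelsBelow_mono T (Nat.le_succ i) r) (rowLen_labelsBelow_succ_le T j (i + 1) r)

theorem le_toggleUpper (j i r : ℕ) :
    (labelsBelow T j (i + 1)).rowLen r ≤ toggleUpper T j i r := by
  unfold toggleUpper
  split_ifs with h
  · subst h; exact rowLen_labelsBelow_mono T (Nat.le_succ _) 0
  · refine le_min ?_ (rowLen_labelsBelow_mono T (Nat.le_succ _) r)
    obtain ⟨r, rfl⟩ := Nat.exists_eq_succ_of_ne_zero h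
    exact rowLen_labelsBelow_succ_le T j i r

theorem toggleLower_le_toggle (j i r : ℕ) : toggleLower T j i r ≤ toggle T j i r := by
  have := le_toggleUpper T j i r
  unfold toggle; omega

theorem toggle_le_toggleUpper (j i r : ℕ) : toggle T j i r ≤ toggleUpper T j i r := by
  have := toggleLower_le T j i r
  unfold toggle; omega

theorem toggleUpper_le (j i r : ℕ) :
    toggleUpper T j i r ≤ (labelsBelow T j (i + 2)).rowLen r := by
  unfold toggleUpper
  split_ifs with h
  · rw [h]
  · exact min_le_right _ _

/-- The entries of the tableau obtained by toggling the labels `i` and `i + 1` in the columns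
`< j`. -/
def benderKnuthEntry (j i r c : ℕ) : ℕ :=
  if (labelsBelow T j i).rowLen r ≤ c ∧ c < (labelsBelow T j (i + 2)).rowLen r then
    if c < toggle T j i r then i else i + 1
  else T r c

theorem benderKnuthEntry_of_mem {j i r c : ℕ} (hB : (r, c) ∈ B) :
    benderKnuthEntry T j i r c =
      if c < j ∧ i ≤ T r c ∧ T r c ≤ i + 1 then
        if c < toggle T j i r then i else i + 1
      else T r c := by
  unfold benderKnuthEntry
  congr 1
  rw [← not_lt, lt_rowLen_labelsBelow, lt_rowLen_labelsBelow]
  simp only [hB, true_and, eq_iff_iff]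
  omega

/-- The Bender–Knuth involution for the labels `i` and `i + 1`, applied to the columns `< j` only.
The result is a tableau if column `j` does not contain the label `i`. -/
def benderKnuth (j i : ℕ) (h : ∀ r, (r, j) ∈ B → T r j ≠ i) : SemistandardYoungTableau B where
  entry := benderKnuthEntry T j i
  row_weak' := by
    intro r c1 c2 hc h2
    have h1 : (r, c1) ∈ B := B.up_left_mem le_rfl hc.le h2
    have hw := T.row_weak hc h2
    rw [benderKnuthEntry_of_mem T h1, benderKnuthEntry_of_mem T h2]
    by_cases hj : c1 < j ∧ j ≤ c2
    · -- across column `j` the label `i` cannot follow `i + 1`, as column `j` does not contain `i`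
      have hjB : (r, j) ∈ B := B.up_left_mem le_rfl hj.2 h2
      have e1 := T.row_weak hj.1 hjB
      have e2 := T.row_weak_of_le hj.2 h2
      have e3 := h r hjB
      split_ifs <;> omega
    · split_ifs <;> omega
  col_strict' := by
    intro r1 r2 c hr h2
    have h1 : (r1, c) ∈ B := B.up_left_mem hr.le le_rfl h2
    have hw := T.col_strict hr h2
    rw [benderKnuthEntry_of_mem T h1, benderKnuthEntry_of_mem T h2]
    by_cases hb : c < j ∧ T r1 c = i ∧ T r2 c = i + 1
    · -- both labels lie in the column, in adjacent rows, and neither is free to change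
      have hr2 : r2 = r1 + 1 := by
        by_contra hne
        have hm : (r1 + 1, c) ∈ B := B.up_left_mem (by omega) le_rfl h2
        have e1 := T.col_strict (Nat.lt_add_one r1) hm
        have e2 := T.col_strict (show r1 + 1 < r2 by omega) h2
        omega
      subst hr2
      have e1 : c < (labelsBelow T j (i + 2)).rowLen (r1 + 1) :=
        (lt_rowLen_labelsBelow T).mpr ⟨h2, hb.1, by omega⟩
      have e2 : ¬ c < (labelsBelow T j i).rowLen r1 := by
        rw [lt_rowLen_labelsBelow]; omega
      have e3 : c < toggle T j i r1 :=
        lt_of_lt_of_le e1 ((le_max_right _ _).trans (toggleLower_le_toggle T j i r1))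
      have e4 : ¬ c < toggle T j i (r1 + 1) := by
        have := toggle_le_toggleUpper T j i (r1 + 1)
        simp only [toggleUpper, Nat.succ_ne_zero, if_false, Nat.add_sub_cancel] at this
        omega
      rw [if_pos (by omega), if_pos e3, if_pos (by omega), if_neg e4]
      omega
    · split_ifs <;> omega
  zeros' := by
    intro r c hB
    have : ¬ c < (labelsBelow T j (i + 2)).rowLen r := by
      rw [lt_rowLen_labelsBelow]; tauto
    rw [benderKnuthEntry, if_neg (by tauto), T.zeros hB]

variable {j i : ℕ} (h : ∀ r, (r, j) ∈ B → T r j ≠ i)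

theorem benderKnuth_apply (r c : ℕ) : benderKnuth T j i h r c = benderKnuthEntry T j i r c := rfl

theorem benderKnuth_apply_of_le {r c : ℕ} (hc : j ≤ c) : benderKnuth T j i h r c = T r c := by
  rw [benderKnuth_apply, benderKnuthEntry, if_neg]
  rintro ⟨-, h2⟩
  rw [lt_rowLen_labelsBelow] at h2
  omega

theorem benderKnuth_eq_iff {r c p : ℕ} (hi : p ≠ i) (hi' : p ≠ i + 1) (hB : (r, c) ∈ B) :
    benderKnuth T j i h r c = p ↔ T r c = p := by
  rw [benderKnuth_apply, benderKnuthEntry_of_mem T hB]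
  split_ifs <;> omega

theorem benderKnuth_lt_iff {r c p : ℕ} (hi : p ≠ i + 1) (hB : (r, c) ∈ B) :
    benderKnuth T j i h r c < p ↔ T r c < p := by
  rw [benderKnuth_apply, benderKnuthEntry_of_mem T hB]
  split_ifs <;> omega

theorem rowLen_labelsBelow_benderKnuth {p : ℕ} (hi : p ≠ i + 1) (r : ℕ) :
    (labelsBelow (benderKnuth T j i h) j p).rowLen r = (labelsBelow T j p).rowLen r := by
  refine eq_of_forall_lt_iff fun c => ?_
  rw [lt_rowLen_labelsBelow, lt_rowLen_labelsBelow]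
  refine and_congr_right fun hB => and_congr_right fun _ => ?_
  exact benderKnuth_lt_iff T h hi hB

theorem rowLen_labelsBelow_benderKnuth_succ (r : ℕ) :
    (labelsBelow (benderKnuth T j i h) j (i + 1)).rowLen r = toggle T j i r := by
  refine eq_of_forall_lt_iff fun c => ?_
  have e1 : c < (labelsBelow T j i).rowLen r → c < toggle T j i r := fun hc =>
    lt_of_lt_of_le hc ((le_max_left _ _).trans (toggleLower_le_toggle T j i r))
  have e2 : c < toggle T j i r → c < (labelsBelow T j (i + 2)).rowLen r := fun hc =>
    lt_of_lt_of_le hc ((toggle_le_toggleUpper T j i r).trans (toggleUpper_le T j i r))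
  rw [lt_rowLen_labelsBelow] at e1 e2 ⊢
  by_cases hB : (r, c) ∈ B ∧ c < j
  · simp only [hB.1, hB.2, true_and] at e1 e2 ⊢
    rw [benderKnuth_apply, benderKnuthEntry_of_mem T hB.1]
    split_ifs <;> omega
  · tauto

theorem toggle_benderKnuth (r : ℕ) :
    toggle (benderKnuth T j i h) j i r = (labelsBelow T j (i + 1)).rowLen r := by
  have e1 := toggleLower_le T j i r
  have e2 := le_toggleUpper T j i r
  rw [toggle, rowLen_labelsBelow_benderKnuth_succ, toggleUpper, toggleLower]
  simp only [rowLen_labelsBelow_benderKnuth T h (show i + 2 ≠ i + 1 by omega),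
    rowLen_labelsBelow_benderKnuth T h (show i ≠ i + 1 by omega)]
  rw [← toggleUpper, ← toggleLower, toggle]
  omega

theorem benderKnuth_apply_ne (r : ℕ) (hB : (r, j) ∈ B) : benderKnuth T j i h r j ≠ i := by
  rw [benderKnuth_apply_of_le T h le_rfl]
  exact h r hB

theorem benderKnuth_benderKnuth :
    benderKnuth (benderKnuth T j i h) j i (benderKnuth_apply_ne T h) = T := by
  ext r c
  have e1 := lt_rowLen_labelsBelow T (j := j) (p := i) (r := r) (c := c)
  have e2 := lt_rowLen_labelsBelow T (j := j) (p := i + 1) (r := r) (c := c)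
  have e3 := lt_rowLen_labelsBelow T (j := j) (p := i + 2) (r := r) (c := c)
  rw [benderKnuth_apply, benderKnuthEntry, toggle_benderKnuth,
    rowLen_labelsBelow_benderKnuth T h (show i + 2 ≠ i + 1 by omega),
    rowLen_labelsBelow_benderKnuth T h (show i ≠ i + 1 by omega)]
  by_cases hB : (r, c) ∈ B
  · rw [benderKnuth_apply, benderKnuthEntry_of_mem T hB]
    simp only [hB, true_and] at e1 e2 e3
    split_ifs <;> omega
  · rw [if_neg (by tauto), SemistandardYoungTableau.zeros _ hB, T.zeros hB]

theorem labelCount_benderKnuth_of_le {j' : ℕ} (hj : j ≤ j') (p : ℕ) :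
    labelCount (benderKnuth T j i h) j' p = labelCount T j' p := by
  unfold labelCount
  congr 1
  refine filter_congr fun c _ => and_congr_right fun hc => ?_
  rw [benderKnuth_apply_of_le T h (hj.trans hc)]

theorem labelCount_benderKnuth_of_ne {p : ℕ} (hi : p ≠ i) (hi' : p ≠ i + 1) :
    labelCount (benderKnuth T j i h) 0 p = labelCount T 0 p := by
  unfold labelCount
  congr 1
  refine filter_congr fun c hc => and_congr_right fun _ => ?_
  exact benderKnuth_eq_iff T h hi hi' hc

theorem card_eq_sum_rowLen (D : YoungDiagram) {R : ℕ} (hR : D.colLen 0 ≤ R) :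
    D.card = ∑ r ∈ range R, D.rowLen r := by
  rw [YoungDiagram.card, card_eq_sum_card_fiberwise (f := Prod.fst) (t := range R)]
  · refine sum_congr rfl fun r _ => ?_
    rw [YoungDiagram.rowLen_eq_card]; rfl
  · intro c hc
    have : (c.1, 0) ∈ D := D.up_left_mem le_rfl (Nat.zero_le _) hc
    rw [YoungDiagram.mem_iff_lt_colLen] at this
    simpa using lt_of_lt_of_le this hR

theorem labelCount_eq_add (p : ℕ) :
    labelCount T 0 p + (labelsBelow T j p).card
      = labelCount T j p + (labelsBelow T j (p + 1)).card := by
  simp only [labelCount, labelsBelow, YoungDiagram.card]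
  rw [← card_union_of_disjoint, ← card_union_of_disjoint]
  · congr 1
    ext c
    simp only [mem_union, mem_filter]
    by_cases hB : c ∈ B.cells <;> simp only [hB, true_and, false_and, or_self]
    omega
  · rw [disjoint_filter]; intros; omega
  · rw [disjoint_filter]; intros; omega

theorem colLen_labelsBelow_le (p : ℕ) : (labelsBelow T j p).colLen 0 ≤ B.colLen 0 := by
  refine le_of_forall_lt fun c hc => ?_
  rw [← YoungDiagram.mem_iff_lt_colLen, ← YoungDiagram.mem_cells] at hc ⊢
  exact (mem_filter.mp hc).1

/-- Toggling exchanges the numbers of labels `i` and `i + 1` in the columns `< j`. -/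
theorem card_labelsBelow_benderKnuth :
    (labelsBelow (benderKnuth T j i h) j (i + 1)).card + (labelsBelow T j (i + 1)).card
      = (labelsBelow T j i).card + (labelsBelow T j (i + 2)).card := by
  set R := B.colLen 0 with hR
  have hz : ∀ p r, R ≤ r → (labelsBelow T j p).rowLen r = 0 := fun p r hr =>
    rowLen_eq_zero _ ((colLen_labelsBelow_le T p).trans hr)
  rw [card_eq_sum_rowLen _ (colLen_labelsBelow_le (benderKnuth T j i h) _),
    card_eq_sum_rowLen _ (colLen_labelsBelow_le T _), card_eq_sum_rowLen _ (colLen_labelsBelow_le T _),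
    card_eq_sum_rowLen _ (colLen_labelsBelow_le T _), ← hR, ← sum_add_distrib]
  have e1 : ∀ r ∈ range R, (labelsBelow (benderKnuth T j i h) j (i + 1)).rowLen r +
      (labelsBelow T j (i + 1)).rowLen r = toggleUpper T j i r + toggleLower T j i r := by
    intro r _
    rw [rowLen_labelsBelow_benderKnuth_succ, toggle]
    have := le_toggleUpper T j i r
    omega
  rw [sum_congr rfl e1, sum_add_distrib]
  -- the upper bounds `min (x (r - 1)) (z r)` pair with the lower bounds `max (x (r - 1)) (z r)`
  have e2 : ∀ n, ∑ r ∈ range n, toggleUpper T j i r + ∑ r ∈ range n, toggleLower T j i r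
      + (if n = 0 then 0 else min ((labelsBelow T j i).rowLen (n - 1))
          ((labelsBelow T j (i + 2)).rowLen n)) + (if n = 0 then (labelsBelow T j (i + 2)).rowLen 0
          else 0)
      = ∑ r ∈ range n, (labelsBelow T j i).rowLen r
        + ∑ r ∈ range n, (labelsBelow T j (i + 2)).rowLen r
        + (labelsBelow T j (i + 2)).rowLen n := by
    intro n
    induction n with
    | zero => simp
    | succ n ih =>
      simp only [sum_range_succ]
      have hu : toggleUpper T j i n = (if n = 0 then 0 else min ((labelsBelow T j i).rowLen (n - 1))
          ((labelsBelow T j (i + 2)).rowLen n)) + (if n = 0 then (labelsBelow T j (i + 2)).rowLen 0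
          else 0) := by
        unfold toggleUpper; split_ifs <;> simp
      have hl := min_add_max ((labelsBelow T j i).rowLen n) ((labelsBelow T j (i + 2)).rowLen (n + 1))
      simp only [toggleLower, Nat.succ_ne_zero, if_false, Nat.add_sub_cancel] at *
      omega
  have e3 := e2 R
  rw [hz _ R le_rfl, Nat.min_zero] at e3
  have h0 : R = 0 → (labelsBelow T j (i + 2)).rowLen 0 = 0 := fun hR0 => hz _ _ (by omega)
  split_ifs at e3 with hR0
  · have := h0 hR0; omega
  · omega

theorem labelCount_benderKnuth_left :
    labelCount (benderKnuth T j i h) 0 i + labelCount T j (i + 1)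
      = labelCount T j i + labelCount T 0 (i + 1) := by
  have e1 := labelCount_eq_add (j := j) (benderKnuth T j i h) i
  have e2 := labelCount_eq_add (j := j) T (i + 1)
  have e3 := card_labelsBelow_benderKnuth T h
  have e4 : (labelsBelow (benderKnuth T j i h) j i).card = (labelsBelow T j i).card := by
    rw [card_eq_sum_rowLen _ (colLen_labelsBelow_le _ _),
      card_eq_sum_rowLen _ (colLen_labelsBelow_le T _)]
    exact sum_congr rfl fun r _ => rowLen_labelsBelow_benderKnuth T h (by omega) r
  rw [labelCount_benderKnuth_of_le T h le_rfl] at e1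
  simp only [add_assoc, Nat.reduceAdd] at e2
  omega

theorem labelCount_benderKnuth_right :
    labelCount (benderKnuth T j i h) 0 (i + 1) + labelCount T j i
      = labelCount T j (i + 1) + labelCount T 0 i := by
  have := labelCount_benderKnuth_left (benderKnuth T j i h) (benderKnuth_apply_ne T h)
  rw [benderKnuth_benderKnuth, labelCount_benderKnuth_of_le T h le_rfl,
    labelCount_benderKnuth_of_le T h le_rfl] at this
  omega

end BenderKnuth

/-! ### Column counts and highest weight tableaux -/

section Columns

variable {B : YoungDiagram} (T : SemistandardYoungTableau B)

/-- As columns are strict, counting cells with a given label is counting columns containing it. -/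
theorem labelCount_eq_card_columns (j p : ℕ) :
    labelCount T j p = #{c ∈ Ico j (B.rowLen 0) | ∃ r < B.colLen c, T r c = p} := by
  refine card_bij (fun c _ => c.2) ?_ ?_ ?_
  · intro c hc
    simp only [mem_filter, YoungDiagram.mem_cells] at hc
    have : (0, c.2) ∈ B := B.up_left_mem (Nat.zero_le _) le_rfl hc.1
    rw [YoungDiagram.mem_iff_lt_rowLen] at this
    simp only [mem_filter, mem_Ico]
    exact ⟨⟨hc.2.1, this⟩, c.1, YoungDiagram.mem_iff_lt_colLen.mp hc.1, hc.2.2⟩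
  · intro c hc d hd hcd
    simp only [mem_filter, YoungDiagram.mem_cells] at hc hd
    refine Prod.ext ?_ hcd
    rcases lt_trichotomy c.1 d.1 with hlt | heq | hlt
    · have := T.col_strict hlt hd.1
      rw [hcd] at hc; omega
    · exact heq
    · have := T.col_strict hlt hc.1
      rw [hcd] at hc this; omega
  · intro c hc
    simp only [mem_filter, mem_Ico] at hc
    obtain ⟨⟨h1, h2⟩, r, hr, hp⟩ := hc
    rw [← YoungDiagram.mem_iff_lt_colLen] at hr
    exact ⟨(r, c), by simp [hr, hp, h1], rfl⟩

theorem labelCount_eq_zero_of_le {j : ℕ} (hj : B.rowLen 0 ≤ j) (p : ℕ) : labelCount T j p = 0 := by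
  rw [labelCount_eq_card_columns, Ico_eq_empty (by omega)]
  rfl

theorem labelCount_of_mem {j p r : ℕ} (hB : (r, j) ∈ B) (hp : T r j = p) :
    labelCount T j p = labelCount T (j + 1) p + 1 := by
  have h0 : (0, j) ∈ B := B.up_left_mem (Nat.zero_le _) le_rfl hB
  rw [YoungDiagram.mem_iff_lt_rowLen] at h0
  rw [labelCount_eq_card_columns, labelCount_eq_card_columns, ← insert_Ico_add_one_left_eq_Ico h0,
    filter_insert, if_pos ⟨r, YoungDiagram.mem_iff_lt_colLen.mp hB, hp⟩,
    card_insert_of_notMem (by simp)]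

theorem labelCount_of_forall_ne {j p : ℕ} (hp : ∀ r, (r, j) ∈ B → T r j ≠ p) :
    labelCount T j p = labelCount T (j + 1) p := by
  unfold labelCount
  congr 1
  refine filter_congr fun c hc => ?_
  constructor
  · rintro ⟨h1, h2⟩
    refine ⟨?_, h2⟩
    rcases Nat.eq_or_lt_of_le h1 with h | h
    · subst h; exact absurd h2 (hp _ hc)
    · exact h
  · rintro ⟨h1, h2⟩; exact ⟨by omega, h2⟩

theorem row_le_label {r c : ℕ} (hB : (r, c) ∈ B) : r ≤ T r c := by
  induction r with
  | zero => exact Nat.zero_le _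
  | succ r ih =>
    have := ih (B.up_left_mem (Nat.le_succ r) le_rfl hB)
    have := T.col_strict (Nat.lt_add_one r) hB
    omega

/-- If among the labels `< n` the counts in the columns `≥ j` are weakly decreasing for every `j`,
then every label `< n` equals the index of its row. -/
theorem label_eq_row {n : ℕ}
    (hT : ∀ j i, i + 1 < n → labelCount T j (i + 1) ≤ labelCount T j i) {r c : ℕ}
    (hB : (r, c) ∈ B) (hn : T r c < n) : T r c = r := by
  -- downward induction on the column, and in each column upward induction on the row
  obtain ⟨d, hd⟩ : ∃ d, d + c = B.rowLen 0 := by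
    have h0 : (0, c) ∈ B := B.up_left_mem (Nat.zero_le _) le_rfl hB
    rw [YoungDiagram.mem_iff_lt_rowLen] at h0
    exact ⟨B.rowLen 0 - c, by omega⟩
  induction d using Nat.strong_induction_on generalizing r c with
  | _ d ihc =>
  induction r using Nat.strong_induction_on with
  | _ r ihr =>
  by_contra hne
  have hle := row_le_label T hB
  obtain ⟨p, hp⟩ : ∃ p, T r c = p + 1 := ⟨T r c - 1, by omega⟩
  have h1 := hT c p (by omega)
  rw [labelCount_of_mem T hB hp] at h1
  -- neither column `c` nor any column to the right of it contains the label `p`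
  have h2 : labelCount T c p = 0 := by
    rw [labelCount, card_eq_zero, filter_eq_empty_iff]
    rintro ⟨r', c'⟩ hB' ⟨hc', hp'⟩
    dsimp only at hc' hp'
    have hr'p : r' = p := by
      rcases Nat.eq_or_lt_of_le hc' with h | h
      · subst h
        have hr' : r' < r := by
          by_contra hge
          have := T.col_weak (not_lt.mp hge) hB'
          omega
        rw [← ihr r' hr' hB' (by omega), hp']
      · have h0 : (0, c') ∈ B := B.up_left_mem (Nat.zero_le _) le_rfl hB'
        rw [YoungDiagram.mem_iff_lt_rowLen] at h0
        rw [← ihc (B.rowLen 0 - c') (by omega) hB' (by omega) (by omega), hp']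
    have e1 : (r, c') ∈ B := B.up_left_mem (by omega) le_rfl hB'
    have e2 := T.row_weak_of_le hc' e1
    have e3 := T.col_weak (show r ≤ r' by omega) hB'
    omega
  omega

end Columns

end SchurCover

namespace SchurCover

open Finset MvPolynomial

/-! ### Schur polynomials in finitely many variables -/

/-- Semistandard tableaux of shape `B` with labels `< N`. -/
def BoundedTableau (N : ℕ) (B : YoungDiagram) : Type :=
  {T : SemistandardYoungTableau B // ∀ r c, (r, c) ∈ B → T r c < N}

instance (N : ℕ) (B : YoungDiagram) : Finite (BoundedTableau N B) := by
  refine Finite.of_injective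
    (fun (T : BoundedTableau N B) (c : B.cells) => (⟨T.1 c.1.1 c.1.2, T.2 _ _ c.2⟩ : Fin N)) ?_
  intro T T' h
  refine Subtype.ext (SemistandardYoungTableau.ext fun r c => ?_)
  by_cases hB : (r, c) ∈ B
  · have := congrFun h ⟨(r, c), hB⟩
    simpa using this
  · rw [T.1.zeros hB, T'.1.zeros hB]

noncomputable instance (N : ℕ) (B : YoungDiagram) : Fintype (BoundedTableau N B) :=
  Fintype.ofFinite _

/-- The monomial `x^f` in the variables indexed by `Fin N`. -/
noncomputable def mono {N : ℕ} (f : Fin N → ℕ) : MvPolynomial (Fin N) ℤ :=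
  monomial (Finsupp.equivFunOnFinite.symm f) 1

/-- The number of occurrences of each label in a tableau with labels `< N`. -/
def weight {N : ℕ} {B : YoungDiagram} (T : BoundedTableau N B) : Fin N → ℕ :=
  fun p => labelCount T.1 0 p

/-- The Schur polynomial in `N` variables, as a sum over tableaux. -/
noncomputable def schurPoly (N : ℕ) (B : YoungDiagram) : MvPolynomial (Fin N) ℤ :=
  ∑ T : BoundedTableau N B, mono (weight T)

section Restriction

variable {N : ℕ}

theorem coeff_mono (f : Fin N → ℕ) (d : Fin N →₀ ℕ) :
    (mono f).coeff d = if f = d then 1 else 0 := by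
  rw [mono, coeff_monomial]
  congr 1
  rw [eq_iff_iff]
  exact ⟨fun h => by rw [← h]; rfl, fun h => by ext; simp [h]⟩

theorem mono_add (f g : Fin N → ℕ) : mono (f + g) = mono f * mono g := by
  have h : Finsupp.equivFunOnFinite.symm (f + g)
      = Finsupp.equivFunOnFinite.symm f + Finsupp.equivFunOnFinite.symm g := by ext; rfl
  rw [mono, mono, mono, monomial_mul, one_mul, h]

theorem content_apply {B : YoungDiagram} (T : SemistandardYoungTableau B) (p : ℕ) :
    content T p = labelCount T 0 p := by
  rw [content, Finsupp.finsetSum_apply, labelCount, card_filter]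
  exact sum_congr rfl fun c _ => by simp [Finsupp.single_apply]

/-- A power series in the variables `x_0, x_1, …` becomes the given polynomial when the variables
from `x_N` on are set to zero. -/
def RestrictsTo (f : MvPowerSeries ℕ ℤ) (p : MvPolynomial (Fin N) ℤ) : Prop :=
  ∀ d : Fin N →₀ ℕ, MvPowerSeries.coeff (d.mapDomain Fin.val) f = p.coeff d

theorem RestrictsTo.unique {f : MvPowerSeries ℕ ℤ} {p q : MvPolynomial (Fin N) ℤ}
    (hp : RestrictsTo f p) (hq : RestrictsTo f q) : p = q :=
  MvPolynomial.ext _ _ fun d => (hp d).symm.trans (hq d)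

theorem RestrictsTo.sub {f g : MvPowerSeries ℕ ℤ} {p q : MvPolynomial (Fin N) ℤ}
    (hp : RestrictsTo f p) (hq : RestrictsTo g q) : RestrictsTo (f - g) (p - q) := fun d => by
  rw [map_sub, coeff_sub, hp, hq]

theorem RestrictsTo.mul {f g : MvPowerSeries ℕ ℤ} {p q : MvPolynomial (Fin N) ℤ}
    (hp : RestrictsTo f p) (hq : RestrictsTo g q) : RestrictsTo (f * g) (p * q) := fun d => by
  rw [← coeff_rename_mapDomain _ Fin.val_injective, map_mul (rename Fin.val), MvPowerSeries.coeff_mul, coeff_mul]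
  have key : ∀ x : ℕ →₀ ℕ, x ≤ d.mapDomain Fin.val → ∃ y : Fin N →₀ ℕ, y.mapDomain Fin.val = x := by
    intro x hx
    refine ⟨x.comapDomain Fin.val Fin.val_injective.injOn, ?_⟩
    refine Finsupp.mapDomain_comapDomain _ Fin.val_injective _ fun a ha => ?_
    by_contra hr
    have h1 := hx a
    rw [Finsupp.mapDomain_of_notMem_range _ _ hr] at h1
    exact Finsupp.mem_support_iff.mp ha (Nat.le_zero.mp h1)
  refine sum_congr rfl fun x hx => ?_
  rw [HasAntidiagonal.mem_antidiagonal] at hx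
  obtain ⟨y, hy⟩ := key x.1 (hx ▸ le_self_add)
  obtain ⟨z, hz⟩ := key x.2 (hx ▸ le_add_self)
  rw [← hy, ← hz, hp, hq, coeff_rename_mapDomain _ Fin.val_injective,
    coeff_rename_mapDomain _ Fin.val_injective]

theorem restrictsTo_sum_nsmul {ι : Type*} (s : Finset ι) (c : ι → ℕ) {f : ι → MvPowerSeries ℕ ℤ}
    {p : ι → MvPolynomial (Fin N) ℤ} (h : ∀ x, RestrictsTo (f x) (p x)) :
    RestrictsTo (∑ x ∈ s, c x • f x) (∑ x ∈ s, c x • p x) := fun d => by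
  rw [map_sum, coeff_sum]
  exact sum_congr rfl fun x _ => by rw [map_nsmul, coeff_smul, h x d]

theorem content_eq_mapDomain_iff {B : YoungDiagram} (T : SemistandardYoungTableau B)
    (d : Fin N →₀ ℕ) : content T = d.mapDomain Fin.val ↔
      (∀ r c, (r, c) ∈ B → T r c < N) ∧ ∀ p : Fin N, labelCount T 0 p = d p := by
  constructor
  · intro h
    refine ⟨fun r c hB => ?_, fun p => ?_⟩
    · by_contra hN
      have h0 : labelCount T 0 (T r c) = 0 := by
        rw [← content_apply, h, Finsupp.mapDomain_of_notMem_range]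
        rintro ⟨p, hp⟩
        exact hN (hp ▸ p.2)
      rw [labelCount, card_eq_zero, filter_eq_empty_iff] at h0
      exact h0 (x := (r, c)) hB ⟨Nat.zero_le _, rfl⟩
    · rw [← content_apply, h, Finsupp.mapDomain_apply Fin.val_injective]
  · rintro ⟨h1, h2⟩
    ext p
    rw [content_apply]
    by_cases hp : p < N
    · rw [h2 ⟨p, hp⟩, ← Finsupp.mapDomain_apply Fin.val_injective d ⟨p, hp⟩]
    · rw [Finsupp.mapDomain_of_notMem_range _ _ (by rintro ⟨q, rfl⟩; exact hp q.2), labelCount,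
        card_eq_zero, filter_eq_empty_iff]
      rintro c hc ⟨-, rfl⟩
      exact hp (h1 _ _ hc)

theorem restrictsTo_schur (B : YoungDiagram) : RestrictsTo (schur B) (schurPoly N B) := fun d => by
  classical
  have e1 : MvPowerSeries.coeff (d.mapDomain Fin.val) (schur B)
      = (Nat.card {T : SemistandardYoungTableau B // content T = d.mapDomain Fin.val} : ℤ) := rfl
  rw [e1, schurPoly, coeff_sum]
  simp only [coeff_mono]
  rw [sum_boole, ← Fintype.card_subtype, ← Nat.card_eq_fintype_card]
  congr 1
  refine Nat.card_congr
    { toFun := fun T => ⟨⟨T.1, ((content_eq_mapDomain_iff _ _).mp T.2).1⟩,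
        funext ((content_eq_mapDomain_iff _ _).mp T.2).2⟩
      invFun := fun T => ⟨T.1.1, (content_eq_mapDomain_iff _ _).mpr ⟨T.1.2, congrFun T.2⟩⟩
      left_inv := fun T => rfl
      right_inv := fun T => rfl }

end Restriction

/-! ### Alternants -/

section Alternants

variable {N : ℕ}

/-- The antisymmetrization `∑_w sgn(w) w(p)` of a polynomial. -/
noncomputable def alternate (p : MvPolynomial (Fin N) ℤ) : MvPolynomial (Fin N) ℤ :=
  ∑ w : Equiv.Perm (Fin N), (Equiv.Perm.sign w : ℤ) • rename w p

theorem alternate_mul {p f : MvPolynomial (Fin N) ℤ} (hf : f.IsSymmetric) :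
    alternate (p * f) = alternate p * f := by
  rw [alternate, alternate, sum_mul]
  exact sum_congr rfl fun w _ => by rw [map_mul, hf w, smul_mul_assoc]

theorem alternate_sum {ι : Type*} (s : Finset ι) (p : ι → MvPolynomial (Fin N) ℤ) :
    alternate (∑ x ∈ s, p x) = ∑ x ∈ s, alternate (p x) := by
  simp only [alternate, map_sum, smul_sum]
  exact sum_comm

theorem alternate_rename (v : Equiv.Perm (Fin N)) (p : MvPolynomial (Fin N) ℤ) :
    alternate (rename v p) = (Equiv.Perm.sign v : ℤ) • alternate p := by
  rw [alternate, alternate, smul_sum]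
  refine Fintype.sum_equiv (Equiv.mulRight v) _ _ fun w => ?_
  rw [rename_rename, Equiv.coe_mulRight, Equiv.Perm.sign_mul, Units.val_mul, smul_smul,
    mul_comm (Equiv.Perm.sign w : ℤ), ← mul_assoc, Int.units_coe_mul_self, one_mul]
  rfl

theorem rename_mono (w : Equiv.Perm (Fin N)) (f : Fin N → ℕ) :
    rename w (mono f) = mono (f ∘ w.symm) := by
  have h : (Finsupp.equivFunOnFinite.symm f).mapDomain w
      = Finsupp.equivFunOnFinite.symm (f ∘ w.symm) := by
    ext p
    rw [Finsupp.mapDomain_equiv_apply]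
    rfl
  rw [mono, rename_monomial, mono, h]

theorem alternate_mono_swap {a b : Fin N} (hab : a ≠ b) (f : Fin N → ℕ) :
    alternate (mono (f ∘ Equiv.swap a b)) = - alternate (mono f) := by
  have := alternate_rename (Equiv.swap a b) (mono f)
  rw [rename_mono, Equiv.symm_swap, Equiv.Perm.sign_swap hab] at this
  simpa using this

/-- The leading monomial of an alternant: only the identity permutation keeps a strictly decreasing
exponent strictly decreasing. -/
theorem coeff_alternate_mono {f g : Fin N → ℕ} (hf : StrictAnti f) (hg : StrictAnti g) :
    (alternate (mono f)).coeff (Finsupp.equivFunOnFinite.symm g) = if f = g then 1 else 0 := by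
  rw [alternate, coeff_sum, sum_eq_single 1]
  · rw [coeff_smul, Equiv.Perm.sign_one, rename_mono, coeff_mono]
    rw [show f ∘ (1 : Equiv.Perm (Fin N)).symm = f from rfl]
    simp only [Units.val_one, one_smul]
    congr 1
  · intro w _ hw
    rw [coeff_smul, rename_mono, coeff_mono, if_neg, smul_zero]
    intro h
    apply hw
    have hmono : StrictMono w.symm := by
      intro a b hab
      have h1 : f (w.symm b) < f (w.symm a) := by
        have ha : f (w.symm a) = g a := congrFun h a
        have hb : f (w.symm b) = g b := congrFun h b
        rw [ha, hb]; exact hg hab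
      exact hf.lt_iff_gt.mp h1
    have h2 := Subsingleton.elim (hmono.orderIsoOfSurjective _ w.symm.surjective)
      (OrderIso.refl (Fin N))
    refine Equiv.ext fun a => ?_
    have h3 : w.symm (w a) = w a := congrArg (fun e : Fin N ≃o Fin N => e (w a)) h2
    rw [Equiv.symm_apply_apply] at h3
    exact h3.symm
  · simp

end Alternants

/-! ### Symmetry of Schur polynomials -/

section Symmetry

variable {N : ℕ} {B : YoungDiagram}

/-- The Bender–Knuth involution on tableaux with bounded labels. -/
def boundedBenderKnuth (T : BoundedTableau N B) (j i : ℕ) (hi : i + 1 < N)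
    (h : ∀ r, (r, j) ∈ B → T.1 r j ≠ i) : BoundedTableau N B :=
  ⟨benderKnuth T.1 j i h, fun r c hB => by
    rcases Nat.eq_or_lt_of_le hi with h' | h'
    · have := T.2 r c hB
      rw [benderKnuth_apply, benderKnuthEntry_of_mem T.1 hB]
      split_ifs <;> omega
    · exact (benderKnuth_lt_iff T.1 h (by omega) hB).mpr (T.2 r c hB)⟩

theorem weight_boundedBenderKnuth (T : BoundedTableau N B) (j i : ℕ) (hi : i + 1 < N)
    (h : ∀ r, (r, j) ∈ B → T.1 r j ≠ i) {f : Fin N → ℕ}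
    (hf : f ⟨i, by omega⟩ + labelCount T.1 j i = f ⟨i + 1, hi⟩ + labelCount T.1 j (i + 1)) :
    f + weight (boundedBenderKnuth T j i hi h)
      = (f + weight T) ∘ Equiv.swap ⟨i, by omega⟩ ⟨i + 1, hi⟩ := by
  have e1 := labelCount_benderKnuth_left T.1 h
  have e2 := labelCount_benderKnuth_right T.1 h
  ext p
  simp only [Function.comp, Pi.add_apply, weight, boundedBenderKnuth]
  by_cases hp : p = ⟨i, by omega⟩
  · subst hp
    rw [Equiv.swap_apply_left]
    dsimp only
    omega
  by_cases hp' : p = ⟨i + 1, hi⟩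
  · subst hp'
    rw [Equiv.swap_apply_right]
    dsimp only
    omega
  rw [Equiv.swap_apply_of_ne_of_ne hp hp', labelCount_benderKnuth_of_ne T.1 h]
  · exact fun h => hp (Fin.ext h)
  · exact fun h => hp' (Fin.ext h)

theorem boundedBenderKnuth_boundedBenderKnuth (T : BoundedTableau N B) (j i : ℕ) (hi : i + 1 < N)
    (h : ∀ r, (r, j) ∈ B → T.1 r j ≠ i) (h') :
    boundedBenderKnuth (boundedBenderKnuth T j i hi h) j i hi h' = T :=
  Subtype.ext (benderKnuth_benderKnuth T.1 h)

theorem rename_swap_schurPoly (i : ℕ) (hi : i + 1 < N) :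
    rename (Equiv.swap (⟨i, by omega⟩ : Fin N) ⟨i + 1, hi⟩) (schurPoly N B) = schurPoly N B := by
  have hno : ∀ T : BoundedTableau N B, ∀ r, (r, B.rowLen 0) ∈ B → T.1 r (B.rowLen 0) ≠ i := by
    intro T r hr
    rw [YoungDiagram.mem_iff_lt_rowLen] at hr
    exact absurd (hr.trans_le (B.rowLen_anti 0 r (Nat.zero_le _))) (lt_irrefl _)
  rw [schurPoly, map_sum]
  refine Fintype.sum_equiv (Function.Involutive.toPerm
    (fun T => boundedBenderKnuth T (B.rowLen 0) i hi (hno T))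
    fun T => boundedBenderKnuth_boundedBenderKnuth T _ i hi _ _) _ _ fun T => ?_
  rw [rename_mono, Equiv.symm_swap]
  change _ = mono (weight (boundedBenderKnuth T (B.rowLen 0) i hi (hno T)))
  have := weight_boundedBenderKnuth T (B.rowLen 0) i hi (hno T) (f := 0)
    (by rw [labelCount_eq_zero_of_le _ le_rfl, labelCount_eq_zero_of_le _ le_rfl]; rfl)
  rw [zero_add, zero_add] at this
  rw [this]

theorem isSymmetric_schurPoly : (schurPoly N B).IsSymmetric := by
  intro w
  cases N with
  | zero => rw [Subsingleton.elim w 1]; exact rename_id_apply _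
  | succ n =>
    have hw : w ∈ Submonoid.closure
        (Set.range fun i : Fin n => Equiv.swap i.castSucc i.succ) := by
      rw [Equiv.Perm.mclosure_swap_castSucc_succ]; trivial
    induction hw using Submonoid.closure_induction with
    | mem v hv =>
      obtain ⟨i, rfl⟩ := hv
      exact rename_swap_schurPoly i (by omega)
    | one => exact rename_id_apply _
    | mul u v _ _ hu hv =>
      rw [Equiv.Perm.coe_mul, ← rename_rename, hv, hu]

end Symmetry

/-! ### The Littlewood–Richardson rule -/

section LittlewoodRichardson

variable {N : ℕ} {B : YoungDiagram}

/-- The tableau `T` is compatible with the partition `A` if adding to `A` the content of the columns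
`≥ j` of `T` gives a weakly decreasing sequence of length `N`, for every `j`. -/
def Compatible (N : ℕ) (A : ℕ → ℕ) (T : SemistandardYoungTableau B) : Prop :=
  ∀ j i, i + 1 < N → A (i + 1) + labelCount T j (i + 1) ≤ A i + labelCount T j i

/-- Column `j` and label `i` are the place at which compatibility with `A` first fails: `j` is as
large as possible and then `i` as small as possible. -/
structure IsDefect (N : ℕ) (A : ℕ → ℕ) (T : SemistandardYoungTableau B) (j i : ℕ) : Prop where
  lt : i + 1 < N
  fails : A i + labelCount T j i < A (i + 1) + labelCount T j (i + 1)
  right : ∀ j' > j, ∀ i', i' + 1 < N →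
    A (i' + 1) + labelCount T j' (i' + 1) ≤ A i' + labelCount T j' i'
  above : ∀ i' < i, A (i' + 1) + labelCount T j (i' + 1) ≤ A i' + labelCount T j i'

variable {A : ℕ → ℕ}

theorem exists_isDefect (hA : Antitone A) {T : SemistandardYoungTableau B}
    (hT : ¬ Compatible N A T) : ∃ j i, IsDefect N A T j i := by
  classical
  let P : ℕ → Prop := fun j => ∃ i, i + 1 < N ∧
    A i + labelCount T j i < A (i + 1) + labelCount T j (i + 1)
  have hbound : ∀ j, P j → j ≤ B.rowLen 0 := by
    rintro j ⟨i, -, hi⟩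
    by_contra hj
    rw [labelCount_eq_zero_of_le T (by omega), labelCount_eq_zero_of_le T (by omega)] at hi
    have := hA (Nat.le_add_right i 1)
    omega
  obtain ⟨j₀, hj₀⟩ : ∃ j, P j := by
    simp only [Compatible, not_forall, not_le] at hT
    obtain ⟨j, i, hi, h⟩ := hT
    exact ⟨j, i, hi, h⟩
  have hP : P (Nat.findGreatest P (B.rowLen 0)) := Nat.findGreatest_spec (hbound _ hj₀) hj₀
  refine ⟨Nat.findGreatest P (B.rowLen 0), Nat.find hP, (Nat.find_spec hP).1, (Nat.find_spec hP).2,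
    ?_, ?_⟩
  · intro j' hj' i' hi'
    by_contra hlt
    have hPj : P j' := ⟨i', hi', not_le.mp hlt⟩
    exact absurd (Nat.le_findGreatest (hbound _ hPj) hPj) (not_le.mpr hj')
  · intro i' hi'
    have h1 := Nat.find_min hP hi'
    have h2 := (Nat.find_spec hP).1
    by_contra hlt
    exact h1 ⟨by omega, not_le.mp hlt⟩

namespace IsDefect

variable {T : SemistandardYoungTableau B} {j i : ℕ}

theorem not_compatible (h : IsDefect N A T j i) : ¬ Compatible N A T := fun hc =>
  absurd (hc j i h.lt) (not_le.mpr h.fails)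

theorem unique {j' i' : ℕ} (h : IsDefect N A T j i) (h' : IsDefect N A T j' i') :
    j = j' ∧ i = i' := by
  have hj : j = j' := by
    rcases lt_trichotomy j j' with hlt | heq | hlt
    · exact absurd (h.right j' hlt i' h'.lt) (not_le.mpr h'.fails)
    · exact heq
    · exact absurd (h'.right j hlt i h.lt) (not_le.mpr h.fails)
  subst hj
  refine ⟨rfl, ?_⟩
  rcases lt_trichotomy i i' with hlt | heq | hlt
  · exact absurd (h'.above i hlt) (not_le.mpr h.fails)
  · exact heq
  · exact absurd (h.above i' hlt) (not_le.mpr h'.fails)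

theorem ne_label (h : IsDefect N A T j i) (r : ℕ) (hB : (r, j) ∈ B) : T r j ≠ i := by
  intro hT
  have h1 := h.right (j + 1) (Nat.lt_succ_self j) i h.lt
  have h2 := h.fails
  rw [labelCount_of_mem T hB hT] at h2
  by_cases hex : ∃ r', (r', j) ∈ B ∧ T r' j = i + 1
  · obtain ⟨r', hr', hT'⟩ := hex
    rw [labelCount_of_mem T hr' hT'] at h2
    omega
  · rw [labelCount_of_forall_ne T (p := i + 1) (fun r' hr' hT' => hex ⟨r', hr', hT'⟩)] at h2
    omega

/-- At the defect the failing inequality fails by exactly one. -/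
theorem add_one_eq (h : IsDefect N A T j i) :
    A i + labelCount T j i + 1 = A (i + 1) + labelCount T j (i + 1) := by
  have h1 := h.right (j + 1) (Nat.lt_succ_self j) i h.lt
  have h2 := h.fails
  rw [labelCount_of_forall_ne T h.ne_label] at h2 ⊢
  by_cases hex : ∃ r', (r', j) ∈ B ∧ T r' j = i + 1
  · obtain ⟨r', hr', hT'⟩ := hex
    rw [labelCount_of_mem T hr' hT'] at h2 ⊢
    omega
  · rw [labelCount_of_forall_ne T (p := i + 1) (fun r' hr' hT' => hex ⟨r', hr', hT'⟩)] at h2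
    omega

theorem benderKnuth (h : IsDefect N A T j i) :
    IsDefect N A (benderKnuth T j i h.ne_label) j i where
  lt := h.lt
  fails := by
    rw [labelCount_benderKnuth_of_le T h.ne_label le_rfl,
      labelCount_benderKnuth_of_le T h.ne_label le_rfl]
    exact h.fails
  right j' hj' i' hi' := by
    rw [labelCount_benderKnuth_of_le T h.ne_label hj'.le,
      labelCount_benderKnuth_of_le T h.ne_label hj'.le]
    exact h.right j' hj' i' hi'
  above i' hi' := by
    rw [labelCount_benderKnuth_of_le T h.ne_label le_rfl,
      labelCount_benderKnuth_of_le T h.ne_label le_rfl]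
    exact h.above i' hi'

end IsDefect

/-- The sequence `A + (N - 1, N - 2, …, 0)`. -/
def shifted (N : ℕ) (A : ℕ → ℕ) : Fin N → ℕ := fun p => A p + (N - 1 - p)

theorem strictAnti_shifted {A : ℕ → ℕ}
    (hA : ∀ i, i + 1 < N → A (i + 1) ≤ A i) : StrictAnti (shifted N A) := by
  have hA' : ∀ d a, a + d < N → A (a + d) ≤ A a := by
    intro d
    induction d with
    | zero => intro a _; exact le_rfl
    | succ d ih => intro a h; exact (hA (a + d) h).trans (ih a (by omega))
  intro a b hab
  have hab' : (a : ℕ) < b := hab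
  have := hA' (b - a) a (by omega)
  rw [show (a : ℕ) + (b - a) = b by omega] at this
  simp only [shifted]
  omega

open Classical in
/-- The alternants of the incompatible tableaux cancel in pairs. -/
theorem sum_not_compatible (hA : Antitone A) :
    ∑ T : BoundedTableau N B with ¬ Compatible N A T.1,
      alternate (mono (shifted N A + weight T)) = 0 := by
  have hex : ∀ T ∈ ({T : BoundedTableau N B | ¬ Compatible N A T.1} : Finset _),
      ∃ x : ℕ × ℕ, IsDefect N A T.1 x.1 x.2 := by
    intro T hT
    obtain ⟨j, i, h⟩ := exists_isDefect hA (mem_filter.mp hT).2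
    exact ⟨(j, i), h⟩
  choose! x hx using hex
  have hneg : ∀ (T : BoundedTableau N B) (j i : ℕ) (h : IsDefect N A T.1 j i),
      alternate (mono (shifted N A + weight (boundedBenderKnuth T j i h.lt h.ne_label)))
        = - alternate (mono (shifted N A + weight T)) := by
    intro T j i h
    have h1 := h.add_one_eq
    have h2 := h.lt
    rw [weight_boundedBenderKnuth T j i h.lt h.ne_label, alternate_mono_swap]
    · intro h; simp at h
    · simp only [shifted]; omega
  refine sum_involution
    (fun T hT => boundedBenderKnuth T (x T).1 (x T).2 (hx T hT).lt (hx T hT).ne_label) ?_ ?_ ?_ ?_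
  · intro T hT
    rw [hneg T _ _ (hx T hT), add_neg_cancel]
  · intro T hT hne heq
    have h1 := hneg T _ _ (hx T hT)
    rw [heq] at h1
    exact hne (self_eq_neg.mp h1)
  · intro T hT
    exact mem_filter.mpr ⟨mem_univ _, (hx T hT).benderKnuth.not_compatible⟩
  · intro T hT
    have hT' : boundedBenderKnuth T (x T).1 (x T).2 (hx T hT).lt (hx T hT).ne_label
        ∈ ({T : BoundedTableau N B | ¬ Compatible N A T.1} : Finset _) :=
      mem_filter.mpr ⟨mem_univ _, (hx T hT).benderKnuth.not_compatible⟩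
    have h1 := (hx T hT).benderKnuth.unique (hx _ hT')
    have hx2 : x (boundedBenderKnuth T (x T).1 (x T).2 (hx T hT).lt (hx T hT).ne_label) = x T :=
      Prod.ext h1.1.symm h1.2.symm
    simp only [hx2]
    exact boundedBenderKnuth_boundedBenderKnuth T _ _ _ _ _

open Classical in
theorem alternate_mul_schurPoly (hA : Antitone A) :
    alternate (mono (shifted N A)) * schurPoly N B =
      ∑ T : BoundedTableau N B with Compatible N A T.1,
        alternate (mono (shifted N A + weight T)) := by
  rw [← alternate_mul isSymmetric_schurPoly, schurPoly, mul_sum, alternate_sum]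
  simp only [← mono_add]
  rw [← sum_filter_add_sum_filter_not univ (fun T : BoundedTableau N B => Compatible N A T.1),
    sum_not_compatible hA, add_zero]

open Classical in
/-- The Littlewood–Richardson rule in alternant form: the coefficient of the leading monomial of the
alternant of `L` counts compatible tableaux. -/
theorem coeff_alternate_mul_schurPoly (hA : Antitone A) {L : ℕ → ℕ}
    (hL : ∀ i, i + 1 < N → L (i + 1) ≤ L i) :
    (alternate (mono (shifted N A)) * schurPoly N B).coeff
        (Finsupp.equivFunOnFinite.symm (shifted N L)) =
      #{T : BoundedTableau N B | Compatible N A T.1 ∧ ∀ p < N, A p + labelCount T.1 0 p = L p} := by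
  rw [alternate_mul_schurPoly hA, coeff_sum, ← filter_filter, card_filter, Nat.cast_sum]
  refine sum_congr rfl fun T hT => ?_
  have hc := (mem_filter.mp hT).2
  have he : shifted N A + weight T = shifted N fun p => A p + labelCount T.1 0 p := by
    ext p
    simp only [shifted, weight, Pi.add_apply]
    omega
  rw [he, coeff_alternate_mono (strictAnti_shifted fun i hi => hc 0 i hi) (strictAnti_shifted hL)]
  simp only [Nat.cast_ite, Nat.cast_one, Nat.cast_zero]
  congr 1
  rw [eq_iff_iff]
  constructor
  · intro h p hp
    have := congrFun h ⟨p, hp⟩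
    simp only [shifted] at this
    omega
  · intro h
    ext p
    simp only [shifted]
    rw [h p p.2]

/-- The highest weight tableau, as a tableau with bounded labels. -/
def boundedHighestWeight (h : B.colLen 0 ≤ N) : BoundedTableau N B :=
  ⟨SemistandardYoungTableau.highestWeight B, fun r c hB => by
    have h0 : (r, 0) ∈ B := B.up_left_mem le_rfl (Nat.zero_le _) hB
    rw [YoungDiagram.mem_iff_lt_colLen] at h0
    rw [SemistandardYoungTableau.highestWeight_apply, if_pos hB]
    omega⟩

theorem labelCount_highestWeight (j p : ℕ) :
    labelCount (SemistandardYoungTableau.highestWeight B) j p = B.rowLen p - j := by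
  rw [labelCount, ← Nat.card_Ico]
  refine card_bij (fun c _ => c.2) ?_ ?_ ?_
  · intro c hc
    obtain ⟨h1, h2, h3⟩ := mem_filter.mp hc
    rw [SemistandardYoungTableau.highestWeight_apply, if_pos ((YoungDiagram.mem_cells _).mp h1)] at h3
    have := YoungDiagram.mem_iff_lt_rowLen.mp ((YoungDiagram.mem_cells _).mp h1)
    rw [h3] at this
    exact mem_Ico.mpr ⟨h2, this⟩
  · intro c hc d hd hcd
    obtain ⟨h1, -, h3⟩ := mem_filter.mp hc
    obtain ⟨h1', -, h3'⟩ := mem_filter.mp hd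
    rw [SemistandardYoungTableau.highestWeight_apply, if_pos ((YoungDiagram.mem_cells _).mp h1)] at h3
    rw [SemistandardYoungTableau.highestWeight_apply,
      if_pos ((YoungDiagram.mem_cells _).mp h1')] at h3'
    exact Prod.ext (h3.trans h3'.symm) hcd
  · intro c hc
    rw [mem_Ico] at hc
    have hB := YoungDiagram.mem_iff_lt_rowLen.mpr hc.2
    exact ⟨(p, c), by simp [hB, hc.1], rfl⟩

/-- The bialternant formula: the highest weight tableau is the only tableau compatible with the
empty partition. -/
theorem alternate_zero_mul_schurPoly (h : B.colLen 0 ≤ N) :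
    alternate (mono (shifted N 0)) * schurPoly N B = alternate (mono (shifted N B.rowLen)) := by
  classical
  rw [alternate_mul_schurPoly (fun _ _ _ => le_rfl : Antitone (0 : ℕ → ℕ)), sum_eq_single_of_mem (boundedHighestWeight h)]
  · congr 2
    ext p
    simp only [Pi.add_apply, shifted, weight, boundedHighestWeight, labelCount_highestWeight,
      Pi.zero_apply]
    omega
  · refine mem_filter.mpr ⟨mem_univ _, fun j i _ => ?_⟩
    simp only [boundedHighestWeight, labelCount_highestWeight, Pi.zero_apply, zero_add]
    have := B.rowLen_anti i (i + 1) (Nat.le_succ i)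
    omega
  · intro T hT hne
    refine absurd ?_ hne
    have hc := (mem_filter.mp hT).2
    refine Subtype.ext (SemistandardYoungTableau.ext fun r c => ?_)
    simp only [boundedHighestWeight, SemistandardYoungTableau.highestWeight_apply]
    split_ifs with hB
    · exact label_eq_row T.1 (n := N) (fun j i hi => by simpa using hc j i hi) hB (T.2 _ _ hB)
    · exact T.1.zeros hB

/-- If the difference of two products of Schur functions is Schur-positive, every tableau
contributing to the second product forces a tableau contributing to the first one. -/
theorem exists_compatible_of_schurPositive {A B A' B' : YoungDiagram}
    (hpos : SchurPositive (schur B * schur A - schur B' * schur A'))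
    (hA : A.colLen 0 ≤ N) (hA' : A'.colLen 0 ≤ N) {L : ℕ → ℕ}
    (hL : ∀ i, i + 1 < N → L (i + 1) ≤ L i) (T' : BoundedTableau N B')
    (hT' : Compatible N A'.rowLen T'.1) (hw : ∀ p < N, A'.rowLen p + labelCount T'.1 0 p = L p) :
    ∃ T : BoundedTableau N B, Compatible N A.rowLen T.1 ∧
      ∀ p < N, A.rowLen p + labelCount T.1 0 p = L p := by
  classical
  obtain ⟨c, hc⟩ := hpos
  have h1 : RestrictsTo (N := N) (schur B * schur A - schur B' * schur A')
      (schurPoly N B * schurPoly N A - schurPoly N B' * schurPoly N A') :=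
    ((restrictsTo_schur B).mul (restrictsTo_schur A)).sub
      ((restrictsTo_schur B').mul (restrictsTo_schur A'))
  have h2 := restrictsTo_sum_nsmul (N := N) c.support c restrictsTo_schur
  rw [hc] at h1
  have h3 := congrArg (fun f => (alternate (mono (shifted N 0)) * f).coeff
    (Finsupp.equivFunOnFinite.symm (shifted N L))) (h1.unique h2)
  simp only [mul_sub, mul_sum, mul_smul_comm] at h3
  rw [mul_comm (schurPoly N B), mul_comm (schurPoly N B'), ← mul_assoc, ← mul_assoc,
    alternate_zero_mul_schurPoly hA, alternate_zero_mul_schurPoly hA', coeff_sub, coeff_sum,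
    coeff_alternate_mul_schurPoly (antitone_rowLen A) hL,
    coeff_alternate_mul_schurPoly (antitone_rowLen A') hL] at h3
  have h4 : (0 : ℤ) ≤ ∑ x ∈ c.support, (c x • (alternate (mono (shifted N 0)) * schurPoly N x)).coeff
      (Finsupp.equivFunOnFinite.symm (shifted N L)) := by
    refine sum_nonneg fun x _ => ?_
    rw [coeff_smul, coeff_alternate_mul_schurPoly (fun _ _ _ => le_rfl : Antitone (0 : ℕ → ℕ)) hL]
    positivity
  have h5 : 0 < #{T : BoundedTableau N B' |
      Compatible N A'.rowLen T.1 ∧ ∀ p < N, A'.rowLen p + labelCount T.1 0 p = L p} :=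
    card_pos.mpr ⟨T', mem_filter.mpr ⟨mem_univ _, hT', hw⟩⟩
  have h6 : 0 < #{T : BoundedTableau N B |
      Compatible N A.rowLen T.1 ∧ ∀ p < N, A.rowLen p + labelCount T.1 0 p = L p} := by
    omega
  obtain ⟨T, hT⟩ := card_pos.mp h6
  exact ⟨T, (mem_filter.mp hT).2⟩

end LittlewoodRichardson

end SchurCover

namespace SchurCover

open Finset

/-! ### Row lengths of diagrams -/

section Diagrams

theorem ext_rowLen {μ ν : YoungDiagram} (h : ∀ r, μ.rowLen r = ν.rowLen r) : μ = ν := by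
  refine SetLike.ext fun c => ?_
  obtain ⟨r, j⟩ := c
  rw [YoungDiagram.mem_iff_lt_rowLen, YoungDiagram.mem_iff_lt_rowLen, h]

theorem rowLen_mono {μ ν : YoungDiagram} (h : ν ≤ μ) (r : ℕ) : ν.rowLen r ≤ μ.rowLen r :=
  le_of_forall_lt fun _ hc => YoungDiagram.mem_iff_lt_rowLen.mp
    (h (YoungDiagram.mem_iff_lt_rowLen.mpr hc))

theorem colLen_mono {μ ν : YoungDiagram} (h : ν ≤ μ) (j : ℕ) : ν.colLen j ≤ μ.colLen j :=
  le_of_forall_lt fun _ hc => YoungDiagram.mem_iff_lt_colLen.mp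
    (h (YoungDiagram.mem_iff_lt_colLen.mpr hc))

theorem lt_rowLen_iff_lt_colLen {μ : YoungDiagram} {r c : ℕ} : c < μ.rowLen r ↔ r < μ.colLen c := by
  rw [← YoungDiagram.mem_iff_lt_rowLen, YoungDiagram.mem_iff_lt_colLen]

theorem mem_transpose_iff_lt_rowLen {μ : YoungDiagram} {r c : ℕ} :
    (r, c) ∈ μ.transpose ↔ r < μ.rowLen c := by
  rw [YoungDiagram.mem_transpose, ← YoungDiagram.mem_iff_lt_rowLen]
  rfl

theorem rowLen_pos_iff {μ : YoungDiagram} {r : ℕ} : 0 < μ.rowLen r ↔ r < μ.colLen 0 :=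
  lt_rowLen_iff_lt_colLen

theorem rowLen_complement (m : ℕ) (μ : YoungDiagram) {p : ℕ} (hp : p < m) :
    (complement m μ).rowLen p = m - μ.rowLen (m - 1 - p) := by
  refine eq_of_forall_lt_iff fun c => ?_
  rw [← YoungDiagram.mem_iff_lt_rowLen, ← YoungDiagram.mem_cells]
  simp only [complement, mem_filter, mem_product, mem_range, YoungDiagram.mem_iff_lt_rowLen]
  omega

theorem colLen_complement_le (m : ℕ) (μ : YoungDiagram) : (complement m μ).colLen 0 ≤ m := by
  refine le_of_forall_lt fun c hc => ?_
  rw [← YoungDiagram.mem_iff_lt_colLen, ← YoungDiagram.mem_cells] at hc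
  simp only [complement, mem_filter, mem_product, mem_range] at hc
  exact hc.1.1

theorem rowLen_square (s r : ℕ) : (square s).rowLen r = if r < s then s else 0 := rowLen_ofRows r

theorem transpose_square (s : ℕ) : (square s).transpose = square s := by
  refine SetLike.ext fun c => ?_
  obtain ⟨r, j⟩ := c
  rw [mem_transpose_iff_lt_rowLen, YoungDiagram.mem_iff_lt_rowLen, rowLen_square, rowLen_square]
  split_ifs <;> omega

theorem mem_dropRows {s : ℕ} {ν : YoungDiagram} {r c : ℕ} :
    (r, c) ∈ dropRows s ν ↔ (r + s, c) ∈ ν := by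
  rw [YoungDiagram.mem_iff_lt_rowLen (i := r + s)]
  exact mem_ofRows

theorem rowLen_dropRows (s : ℕ) (ν : YoungDiagram) (r : ℕ) :
    (dropRows s ν).rowLen r = ν.rowLen (r + s) := rowLen_ofRows r

theorem exists_cells_eq_insert {μ ν : YoungDiagram} (h : ν ≤ μ) (hcard : μ.card = ν.card + 1) :
    ∃ c, c ∉ ν ∧ μ.cells = insert c ν.cells := by
  have h1 : #(μ.cells \ ν.cells) = 1 := by
    rw [card_sdiff_of_subset (YoungDiagram.cells_subset_iff.mpr h)]
    change μ.card - ν.card = 1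
    omega
  obtain ⟨c, hc⟩ := card_eq_one.mp h1
  have hmem : c ∈ μ.cells \ ν.cells := hc ▸ mem_singleton_self c
  refine ⟨c, (mem_sdiff.mp hmem).2, ?_⟩
  rw [insert_eq, ← hc, sdiff_union_of_subset (YoungDiagram.cells_subset_iff.mpr h)]

theorem rowLen_of_cells_eq_insert {μ ν : YoungDiagram} {c : ℕ × ℕ} (hc : c ∉ ν)
    (h : μ.cells = insert c ν.cells) (r : ℕ) :
    μ.rowLen r = ν.rowLen r + if r = c.1 then 1 else 0 := by
  rw [YoungDiagram.rowLen_eq_card, YoungDiagram.rowLen_eq_card, YoungDiagram.row, h, filter_insert]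
  split_ifs with h1 h2 h2
  · rw [card_insert_of_notMem fun hmem => hc (mem_filter.mp hmem).1]; rfl
  · exact absurd h1.symm h2
  · exact absurd h2.symm h1
  · rfl

theorem snd_of_cells_eq_insert {μ ν : YoungDiagram} {c : ℕ × ℕ} (hc : c ∉ ν)
    (h : μ.cells = insert c ν.cells) : c.2 = ν.rowLen c.1 := by
  have h1 : c ∈ μ := by rw [← YoungDiagram.mem_cells, h]; exact mem_insert_self _ _
  have h2 := rowLen_of_cells_eq_insert hc h c.1
  rw [if_pos rfl] at h2
  have h3 : c.2 < μ.rowLen c.1 := YoungDiagram.mem_iff_lt_rowLen.mp h1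
  have h4 : ¬ c.2 < ν.rowLen c.1 := fun hlt => hc (YoungDiagram.mem_iff_lt_rowLen.mpr hlt)
  omega

theorem isOuterCorner_dropRows {μ ν : YoungDiagram} {c : ℕ × ℕ} (hc : c ∉ ν)
    (h : μ.cells = insert c ν.cells) {s : ℕ} (hs : s ≤ c.1) :
    IsOuterCorner (dropRows s ν) (c.1 - s, c.2) := by
  have key : ∀ x : ℕ × ℕ, x ∈ insert (c.1 - s, c.2) ((dropRows s ν).cells : Set (ℕ × ℕ)) ↔
      (x.1 + s, x.2) ∈ μ := by
    intro x
    rw [← YoungDiagram.mem_cells, h, mem_insert, YoungDiagram.mem_cells, ← mem_dropRows,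
      Set.mem_insert_iff, mem_coe, YoungDiagram.mem_cells, Prod.ext_iff, Prod.ext_iff]
    have : x.1 = c.1 - s ↔ x.1 + s = c.1 := by omega
    simp only [this]
  constructor
  · rw [mem_dropRows, Nat.sub_add_cancel hs]
    exact hc
  · intro x y hxy hx
    rw [key] at hx ⊢
    exact μ.up_left_mem (Nat.add_le_add_right hxy.1 s) hxy.2 hx

end Diagrams

/-! ### Tableaux contributing to the product for `ν` -/

section Existence

variable {B : YoungDiagram}

theorem labelCount_eq_card_of_unique_row (T : SemistandardYoungTableau B) {j p : ℕ} (row : ℕ → ℕ)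
    (J : Finset ℕ) (h : ∀ r c, ((r, c) ∈ B ∧ j ≤ c ∧ T r c = p) ↔ c ∈ J ∧ r = row c) :
    labelCount T j p = #J := by
  rw [labelCount, ← card_image_of_injective J
    (f := fun c => (row c, c)) fun _ _ hab => (Prod.ext_iff.mp hab).2]
  congr 1
  ext ⟨r, c⟩
  simp only [mem_filter, YoungDiagram.mem_cells, mem_image, Prod.mk.injEq]
  rw [h]
  constructor
  · rintro ⟨h1, rfl⟩; exact ⟨c, h1, rfl, rfl⟩
  · rintro ⟨c', h1, rfl, rfl⟩; exact ⟨h1, rfl⟩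

/-- The target exponent: the square `(m^m)` with the diagram `η` removed in its lower right corner
and the conjugate of `η` attached on its right. -/
def targetRow (m : ℕ) (η : YoungDiagram) (p : ℕ) : ℕ := m + η.colLen p - η.rowLen (m - 1 - p)

theorem targetRow_succ_le (m : ℕ) (η : YoungDiagram) (i : ℕ) :
    targetRow m η (i + 1) ≤ targetRow m η i := by
  have h1 := η.colLen_anti i (i + 1) (Nat.le_succ i)
  have h2 := η.rowLen_anti (m - 1 - (i + 1)) (m - 1 - i) (by omega)
  unfold targetRow
  omega

/-- The tableau `T` contributes the exponent `targetRow m η` to the product of the Schur functions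
of `μ'` and of the complement of `μ`. -/
structure Contributes (m : ℕ) (μ η : YoungDiagram) (T : SemistandardYoungTableau μ.transpose) :
    Prop where
  bounded : ∀ r c, (r, c) ∈ μ.transpose → T r c < m
  compatible : Compatible m (complement m μ).rowLen T
  weight_eq : ∀ p < m, (complement m μ).rowLen p + labelCount T 0 p = targetRow m η p

/-- `ν` is obtained from `η` by adding the rows of the self-conjugate partition `ρ` to the rows of
`η` from row `a` on. -/
structure IsSelfConjugateExtension (ν η ρ : YoungDiagram) (a : ℕ) : Prop where
  transpose_eq : ρ.transpose = ρ
  rowLen_eq : ∀ r, ν.rowLen r = η.rowLen r + if r < a then 0 else ρ.rowLen (r - a)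

variable {ν η ρ : YoungDiagram} {a m : ℕ}

namespace IsSelfConjugateExtension

theorem rowLen_le (h : IsSelfConjugateExtension ν η ρ a) (r : ℕ) :
    η.rowLen r ≤ ν.rowLen r := by
  have := h.rowLen_eq r
  omega

theorem lt_rowLen_comm (h : IsSelfConjugateExtension ν η ρ a) {x y : ℕ} :
    x < ρ.rowLen y ↔ y < ρ.rowLen x := by
  conv_lhs => rw [← h.transpose_eq]
  rw [YoungDiagram.rowLen_transpose, lt_rowLen_iff_lt_colLen]

/-- The rows in which `ρ` is added lie in `ν`. -/
theorem add_rowLen_le (h : IsSelfConjugateExtension ν η ρ a) (h0 : 0 < ρ.rowLen 0) :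
    a + ρ.rowLen 0 ≤ ν.colLen 0 := by
  have h1 : 0 < ρ.rowLen (ρ.rowLen 0 - 1) := h.lt_rowLen_comm.mp (by omega)
  have h2 := h.rowLen_eq (a + (ρ.rowLen 0 - 1))
  rw [if_neg (by omega), Nat.add_sub_cancel_left] at h2
  have h3 := rowLen_pos_iff.mp (show 0 < ν.rowLen (a + (ρ.rowLen 0 - 1)) by omega)
  omega

theorem cell_cases (h : IsSelfConjugateExtension ν η ρ a) {r c : ℕ}
    (hc : (r, c) ∈ ν.transpose) :
    r < ν.rowLen c ∧ c < ν.colLen 0 ∧ ν.rowLen c ≤ ν.rowLen 0 ∧ (r < η.rowLen c ∨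
      (η.rowLen c ≤ r ∧ a ≤ c ∧ ν.rowLen c = η.rowLen c + ρ.rowLen (c - a) ∧
        a + ρ.rowLen (c - a) ≤ ν.colLen 0)) := by
  rw [mem_transpose_iff_lt_rowLen] at hc
  refine ⟨hc, rowLen_pos_iff.mp (by omega), ν.rowLen_anti 0 c (Nat.zero_le _), ?_⟩
  rcases lt_or_ge r (η.rowLen c) with h1 | h1
  · exact Or.inl h1
  · have h2 := h.rowLen_eq c
    split_ifs at h2 with h3
    · omega
    · have h4 := ρ.rowLen_anti 0 (c - a) (Nat.zero_le _)
      have h5 := h.add_rowLen_le (by omega)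
      exact Or.inr ⟨h1, by omega, h2, by omega⟩

/-- The tableau whose restriction to `η'` is the highest weight tableau, and whose other cells, which
form the shape of `ρ`, carry the lowest weight tableau in the labels `< m - a`. -/
def tableau (h : IsSelfConjugateExtension ν η ρ a) (hm : ν.rowLen 0 + ν.colLen 0 ≤ m) :
    SemistandardYoungTableau ν.transpose where
  entry r c := if (r, c) ∈ ν.transpose then
    if r < η.rowLen c then r else m + r - a - ν.rowLen c else 0
  row_weak' := by
    intro r c1 c2 hc h2
    have h1 := ν.transpose.up_left_mem le_rfl hc.le h2
    rw [if_pos h1, if_pos h2]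
    have e1 := η.rowLen_anti c1 c2 hc.le
    have e2 := ν.rowLen_anti c1 c2 hc.le
    have f1 := h.cell_cases h1
    have f2 := h.cell_cases h2
    split_ifs <;> omega
  col_strict' := by
    intro r1 r2 c hr h2
    have h1 := ν.transpose.up_left_mem hr.le le_rfl h2
    rw [if_pos h1, if_pos h2]
    have f1 := h.cell_cases h1
    have f2 := h.cell_cases h2
    split_ifs <;> omega
  zeros' := fun hc => if_neg hc

variable (h : IsSelfConjugateExtension ν η ρ a) (hm : ν.rowLen 0 + ν.colLen 0 ≤ m)

theorem tableau_apply {r c : ℕ} (hc : (r, c) ∈ ν.transpose) :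
    h.tableau hm r c = if r < η.rowLen c then r else m + r - a - ν.rowLen c :=
  if_pos hc

theorem labelCount_tableau (j : ℕ) {p : ℕ} (hp : p < m) :
    labelCount (h.tableau hm) j p = (η.colLen p - j) +
      ((if m - 1 - p < a then 0 else ρ.rowLen (m - 1 - p - a)) - (j - a)) := by
  rcases lt_or_ge p (m - ν.colLen 0) with hlt | hge
  · have e0 : (if m - 1 - p < a then 0 else ρ.rowLen (m - 1 - p - a)) = 0 := by
      have e1 := h.rowLen_eq (m - 1 - p)
      have e2 := rowLen_eq_zero ν (r := m - 1 - p) (by omega)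
      omega
    rw [e0, Nat.zero_sub, Nat.add_zero, ← Nat.card_Ico]
    refine labelCount_eq_card_of_unique_row _ (fun _ => p) _ fun r c => ?_
    rw [mem_Ico, ← lt_rowLen_iff_lt_colLen]
    constructor
    · rintro ⟨hc, hj, hT⟩
      rw [tableau_apply h hm hc] at hT
      have := h.cell_cases hc
      split_ifs at hT <;> omega
    · rintro ⟨⟨hj, hc⟩, rfl⟩
      have hmem : (r, c) ∈ ν.transpose :=
        mem_transpose_iff_lt_rowLen.mpr (hc.trans_le (h.rowLen_le c))
      exact ⟨hmem, hj, by rw [tableau_apply h hm hmem, if_pos hc]⟩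
  · have e0 : η.colLen p = 0 := by
      by_contra hne
      have e1 := lt_rowLen_iff_lt_colLen.mpr (Nat.pos_of_ne_zero hne)
      have e2 := h.rowLen_le 0
      omega
    rw [e0, Nat.zero_sub, Nat.zero_add]
    by_cases hr : m - 1 - p < a
    · rw [if_pos hr, Nat.zero_sub, labelCount, card_eq_zero, filter_eq_empty_iff]
      rintro ⟨x, c⟩ hc ⟨hj, hT⟩
      rw [YoungDiagram.mem_cells] at hc
      rw [tableau_apply h hm hc] at hT
      have := h.cell_cases hc
      split_ifs at hT <;> omega
    · rw [if_neg hr]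
      set t := m - 1 - p - a with ht
      have hcard : ρ.rowLen t - (j - a) = #(Ico (max j a) (a + ρ.rowLen t)) := by
        rw [Nat.card_Ico]; omega
      rw [hcard]
      refine labelCount_eq_card_of_unique_row _ (fun c => ν.rowLen c - 1 - t) _ fun x c => ?_
      rw [mem_Ico]
      have hsymm := h.lt_rowLen_comm (x := t) (y := c - a)
      constructor
      · rintro ⟨hc, hj, hT⟩
        rw [tableau_apply h hm hc] at hT
        have := h.cell_cases hc
        split_ifs at hT <;> omega
      · rintro ⟨⟨h1, h2⟩, rfl⟩
        have e1 := h.rowLen_eq c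
        rw [if_neg (by omega)] at e1
        have hmem : (ν.rowLen c - 1 - t, c) ∈ ν.transpose :=
          mem_transpose_iff_lt_rowLen.mpr (by omega)
        have := h.cell_cases hmem
        refine ⟨hmem, by omega, ?_⟩
        rw [tableau_apply h hm hmem, if_neg (by omega)]
        omega

theorem contributes_tableau : Contributes m ν η (h.tableau hm) where
  bounded r c hc := by
    rw [tableau_apply h hm hc]
    have := h.cell_cases hc
    split_ifs <;> omega
  compatible j i hi := by
    rw [rowLen_complement m ν (by omega), rowLen_complement m ν (by omega),
      labelCount_tableau h hm j (by omega), labelCount_tableau h hm j (by omega)]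
    have e0 := η.colLen_anti i (i + 1) (Nat.le_succ i)
    obtain ⟨r, hr⟩ : ∃ r, m - 1 - (i + 1) = r := ⟨_, rfl⟩
    have hr' : m - 1 - i = r + 1 := by omega
    rw [hr, hr']
    have e1 := h.rowLen_eq r
    have e2 := h.rowLen_eq (r + 1)
    have e3 := η.rowLen_anti r (r + 1) (Nat.le_succ r)
    have e4 := ν.rowLen_anti r (r + 1) (Nat.le_succ r)
    have e5 := ν.rowLen_anti 0 r (Nat.zero_le r)
    have e6 := ρ.rowLen_anti (r - a) (r + 1 - a) (by omega)
    split_ifs at * <;> omega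
  weight_eq p hp := by
    rw [rowLen_complement m ν hp, labelCount_tableau h hm 0 hp, targetRow]
    have e1 := h.rowLen_eq (m - 1 - p)
    have e2 := ν.rowLen_anti 0 (m - 1 - p) (Nat.zero_le _)
    omega

/-- If `μ` covers `ν`, some tableau contributes the exponent of `η` to the product for `μ`, since
one contributes to the product for `ν`. -/
theorem exists_contributes_of_covers (h : IsSelfConjugateExtension ν η ρ a)
    (hm : ν.rowLen 0 + ν.colLen 0 ≤ m) {μ : YoungDiagram} (hcov : Covers m μ ν) :
    ∃ T, Contributes m μ η T := by
  obtain ⟨T, h1, h2⟩ := exists_compatible_of_schurPositive hcov.schurPositive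
    (colLen_complement_le m μ) (colLen_complement_le m ν) (fun i _ => targetRow_succ_le m η i)
    ⟨h.tableau hm, (h.contributes_tableau hm).bounded⟩ (h.contributes_tableau hm).compatible
    (h.contributes_tableau hm).weight_eq
  exact ⟨T.1, T.2, h1, h2⟩

end IsSelfConjugateExtension

end Existence

/-! ### Restrictions on tableaux contributing to the product for `μ` -/

section Vanishing

variable {μ η : YoungDiagram} {m : ℕ} {T : SemistandardYoungTableau μ.transpose}

namespace Contributes

theorem labelCount_large (h : Contributes m μ η T) (hm : μ.rowLen 0 + μ.colLen 0 ≤ m) (hη : η ≤ μ)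
    {r : ℕ} (hr : r < μ.colLen 0) :
    labelCount T 0 (m - 1 - r) = μ.rowLen r - η.rowLen r := by
  have e1 := h.weight_eq (m - 1 - r) (by omega)
  rw [rowLen_complement m μ (by omega), targetRow, show m - 1 - (m - 1 - r) = r by omega] at e1
  have e2 : η.colLen (m - 1 - r) = 0 := by
    by_contra hne
    have e3 := lt_rowLen_iff_lt_colLen.mpr (Nat.pos_of_ne_zero hne)
    have e4 := rowLen_mono hη 0
    omega
  have e3 := rowLen_mono hη r
  have e4 := μ.rowLen_anti 0 r (Nat.zero_le r)
  omega

/-- The labels `< m - ℓ(μ)` fill exactly the cells of `η'`: compatibility forces each of them into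
the row of the same index. -/
theorem label_lt_iff (h : Contributes m μ η T) (hm : μ.rowLen 0 + μ.colLen 0 ≤ m) (hη : η ≤ μ)
    {r c : ℕ} (hc : (r, c) ∈ μ.transpose) : T r c < m - μ.colLen 0 ↔ r < η.rowLen c := by
  set n := m - μ.colLen 0 with hn
  have hA : ∀ p < n, (complement m μ).rowLen p = m := by
    intro p hp
    rw [rowLen_complement m μ (by omega), rowLen_eq_zero μ (by omega), Nat.sub_zero]
  have hrow : ∀ {r c : ℕ}, (r, c) ∈ μ.transpose → T r c < n → T r c = r := by
    intro r c hrc hlt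
    refine label_eq_row T (n := n) (fun j i hi => ?_) hrc hlt
    have := h.compatible j i (by omega)
    rw [hA _ hi, hA _ (by omega)] at this
    omega
  have hrn : r < n := by
    have e1 := mem_transpose_iff_lt_rowLen.mp hc
    have e2 := μ.rowLen_anti 0 c (Nat.zero_le c)
    omega
  -- the labels `< n` form an initial segment `J` of row `r`, of length `η'_r`
  set J : Finset ℕ := {x ∈ range (μ.colLen r) | T r x < n} with hJ
  have hJmem : ∀ x, x ∈ J ↔ (r, x) ∈ μ.transpose ∧ T r x < n := by
    intro x
    rw [hJ, mem_filter, mem_range, mem_transpose_iff_lt_rowLen, lt_rowLen_iff_lt_colLen]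
  have hJcard : #J = η.colLen r := by
    rw [← labelCount_eq_card_of_unique_row T (j := 0) (p := r) (fun _ => r) J]
    · have e1 := h.weight_eq r (by omega)
      rw [hA r hrn, targetRow, rowLen_eq_zero η (r := m - 1 - r)] at e1
      · omega
      · have := colLen_mono hη 0
        omega
    · intro x y
      rw [hJmem]
      constructor
      · rintro ⟨h1, -, h2⟩
        have h3 := hrow h1 (by omega)
        have hx : x = r := by omega
        subst hx
        exact ⟨⟨h1, by omega⟩, rfl⟩
      · rintro ⟨⟨h1, h2⟩, rfl⟩
        exact ⟨h1, Nat.zero_le _, hrow h1 h2⟩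
  rw [lt_rowLen_iff_lt_colLen, ← hJcard]
  constructor
  · intro hlt
    have hsub : range (c + 1) ⊆ J := by
      intro x hx
      rw [mem_range] at hx
      rw [hJmem]
      exact ⟨μ.transpose.up_left_mem le_rfl (by omega) hc,
        (T.row_weak_of_le (by omega) hc).trans_lt hlt⟩
    simpa using card_le_card hsub
  · intro hlt
    by_contra hge
    have hsub : J ⊆ range c := by
      intro x hx
      rw [hJmem] at hx
      rw [mem_range]
      by_contra hx'
      have := T.row_weak_of_le (not_lt.mp hx') hx.1
      omega
    have := card_le_card hsub
    rw [card_range] at this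
    omega

/-- A skew shape `μ / η` in the first `s` rows has no row of length `> s`: each label occurs at most
once in each of the `s` columns of `μ' / η'`. -/
theorem rowLen_le_add (h : Contributes m μ η T) (hm : μ.rowLen 0 + μ.colLen 0 ≤ m) (hη : η ≤ μ)
    {s : ℕ} (hs : ∀ r, s ≤ r → μ.rowLen r = η.rowLen r) (k : ℕ) :
    μ.rowLen k ≤ η.rowLen k + s := by
  rcases lt_or_ge k (μ.colLen 0) with hk | hk
  · have e1 := h.labelCount_large hm hη hk
    rw [labelCount_eq_card_columns] at e1
    have e2 : {c ∈ Ico 0 (μ.transpose.rowLen 0) | ∃ r < μ.transpose.colLen c, T r c = m - 1 - k}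
        ⊆ range s := by
      intro c hc
      obtain ⟨r, hr, hT⟩ := (mem_filter.mp hc).2
      have hmem := YoungDiagram.mem_iff_lt_colLen.mpr hr
      have e3 := h.label_lt_iff hm hη hmem
      rw [YoungDiagram.colLen_transpose] at hr
      rw [mem_range]
      by_contra hge
      have := hs c (not_lt.mp hge)
      omega
    have e3 := card_le_card e2
    rw [card_range] at e3
    omega
  · rw [rowLen_eq_zero μ hk]
    exact Nat.zero_le _

/-- The rows `a, …, k` of `η` having length `b`, the shape `μ / η` cannot consist of a self-conjugate
partition with `k - a` rows and a single cell in row `k` below it: that cell demands one label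
`m - 1 - k`, which can be neither in column `a` of `μ' / η'` nor to the right of it. -/
theorem not_cell_below (h : Contributes m μ η T) (hm : μ.rowLen 0 + μ.colLen 0 ≤ m) (hη : η ≤ μ)
    {a b k : ℕ} (hak : a < k) (hb : ∀ r, a ≤ r → r ≤ k → η.rowLen r = b)
    (hlow : ∀ r < a, μ.rowLen r = η.rowLen r) (hhigh : ∀ r > k, μ.rowLen r = η.rowLen r)
    (ha : μ.rowLen a = b + (k - a)) (hk : μ.rowLen k = b + 1) : False := by
  have hkl : k < μ.colLen 0 := rowLen_pos_iff.mp (by omega)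
  have hcol : ∀ {x c : ℕ}, (x, c) ∈ μ.transpose → m - μ.colLen 0 ≤ T x c →
      a ≤ c ∧ c ≤ k ∧ b ≤ x := by
    intro x c hxc hT
    have e1 := h.label_lt_iff hm hη hxc
    have e2 := mem_transpose_iff_lt_rowLen.mp hxc
    have e3 : a ≤ c := by
      by_contra hlt
      have := hlow c (not_le.mp hlt)
      omega
    have e4 : c ≤ k := by
      by_contra hlt
      have := hhigh c (not_le.mp hlt)
      omega
    have := hb c e3 e4
    omega
  have hcount : ∀ r, r ≤ k → labelCount T a (m - 1 - r) = μ.rowLen r - η.rowLen r := by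
    intro r hr
    rw [← h.labelCount_large hm hη (by omega), labelCount, labelCount]
    congr 1
    refine filter_congr fun c hc => ⟨fun hc' => ⟨Nat.zero_le _, hc'.2⟩, fun hc' => ⟨?_, hc'.2⟩⟩
    exact (hcol hc (by omega)).1
  -- column `a` does not contain the label of row `k`, as it would contain those of rows `a, …, k`
  have hno : ∀ x, (x, a) ∈ μ.transpose → T x a ≠ m - 1 - k := by
    intro x hx hT
    have hall : ∀ d r, r + d = k → a ≤ r → ∃ y, (y, a) ∈ μ.transpose ∧ T y a = m - 1 - r := by
      intro d
      induction d with
      | zero => intro r hr _; exact ⟨x, hx, by rw [hT, ← hr]; rfl⟩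
      | succ d ih =>
        intro r hr har
        obtain ⟨y, hy, hTy⟩ := ih (r + 1) (by omega) (by omega)
        by_contra hex
        have e1 := h.compatible (a + 1) (m - 1 - (r + 1)) (by omega)
        rw [rowLen_complement m μ (by omega), rowLen_complement m μ (by omega),
          show m - 1 - (m - 1 - (r + 1)) = r + 1 by omega,
          show m - 1 - (r + 1) + 1 = m - 1 - r by omega,
          show m - 1 - (m - 1 - r) = r by omega] at e1
        have e2 := labelCount_of_mem T hy hTy
        have e3 := labelCount_of_forall_ne T (p := m - 1 - r)
          (fun y hy hTy => hex ⟨y, hy, hTy⟩)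
        rw [hcount _ (by omega)] at e2 e3
        have e4 := hb r har (by omega)
        have e5 := hb (r + 1) (by omega) (by omega)
        have e6 := rowLen_mono hη r
        have e7 := μ.rowLen_anti 0 r (Nat.zero_le _)
        have e8 := μ.rowLen_anti 0 (r + 1) (Nat.zero_le _)
        omega
    choose! y hy hTy using fun r (hr : a ≤ r ∧ r ≤ k) =>
      hall (k - r) r (Nat.add_sub_cancel' hr.2) hr.1
    have hcard : #(Icc a k) ≤ #(Ico b (μ.rowLen a)) := by
      refine card_le_card_of_injOn y ?_ ?_
      · intro r hr
        have hr' := mem_Icc.mp hr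
        have e1 := hcol (hy r hr') (by rw [hTy r hr']; omega)
        have e2 := mem_transpose_iff_lt_rowLen.mp (hy r hr')
        exact mem_Ico.mpr ⟨e1.2.2, e2⟩
      · intro r hr r' hr' heq
        have hr := mem_Icc.mp hr
        have hr' := mem_Icc.mp hr'
        have e1 := hTy r hr
        have e2 := hTy r' hr'
        rw [heq] at e1
        omega
    rw [Nat.card_Icc, Nat.card_Ico] at hcard
    omega
  -- but then its occurrence further right forces it to be the first new entry of column `a`
  have hpos : 0 < labelCount T 0 (m - 1 - k) := by
    rw [h.labelCount_large hm hη hkl, hk, hb k hak.le le_rfl]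
    omega
  obtain ⟨⟨x, c⟩, hxc⟩ := card_pos.mp hpos
  obtain ⟨hmem, -, hT⟩ := mem_filter.mp hxc
  rw [YoungDiagram.mem_cells] at hmem
  dsimp only at hT
  obtain ⟨e1, e2, e3⟩ := hcol hmem (by omega)
  have hba : (b, a) ∈ μ.transpose := μ.transpose.up_left_mem e3 e1 hmem
  have e4 : T b a ≤ T x c :=
    (T.row_weak_of_le e1 (μ.transpose.up_left_mem e3 le_rfl hmem)).trans (T.col_weak e3 hmem)
  have e5 := h.label_lt_iff hm hη hba
  rw [hb a le_rfl hak.le] at e5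
  obtain ⟨r, hr⟩ : ∃ r, T b a = m - 1 - r ∧ k ≤ r ∧ r < μ.colLen 0 :=
    ⟨m - 1 - T b a, by omega, by omega, by omega⟩
  have hpos' : 0 < labelCount T 0 (m - 1 - r) :=
    card_pos.mpr ⟨(b, a), mem_filter.mpr ⟨(YoungDiagram.mem_cells _).mpr hba, Nat.zero_le _, hr.1⟩⟩
  rw [h.labelCount_large hm hη hr.2.2] at hpos'
  have hrk : r = k := by
    by_contra hne
    have := hhigh r (by omega)
    omega
  exact hno b hba (by rw [hr.1, hrk])

end Contributes

end Vanishing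

/-! ### Covers -/

section Covering

variable {μ ν : YoungDiagram} {m : ℕ}

/-- A self-conjugate shape `ν / η`, expressed through row lengths. -/
theorem rowLen_of_isSelfConjugateShape {η ρ : YoungDiagram} {a b : ℕ}
    (h : ν.cells \ η.cells = ρ.cells.image fun c => (c.1 + a, c.2 + b)) (hη : η ≤ ν) (r : ℕ) :
    (ν.rowLen r = η.rowLen r + if r < a then 0 else ρ.rowLen (r - a)) ∧
      (a ≤ r → 0 < ρ.rowLen (r - a) → η.rowLen r = b) := by
  have key : ∀ c, (η.rowLen r ≤ c ∧ c < ν.rowLen r) ↔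
      (a ≤ r ∧ b ≤ c ∧ c - b < ρ.rowLen (r - a)) := by
    intro c
    have h1 : (r, c) ∈ ν.cells \ η.cells ↔ (η.rowLen r ≤ c ∧ c < ν.rowLen r) := by
      rw [mem_sdiff, YoungDiagram.mem_cells, YoungDiagram.mem_cells, YoungDiagram.mem_iff_lt_rowLen,
        YoungDiagram.mem_iff_lt_rowLen, not_lt, and_comm]
    rw [← h1, h, mem_image]
    constructor
    · rintro ⟨⟨x, y⟩, hxy, heq⟩
      simp only [Prod.mk.injEq] at heq
      obtain ⟨rfl, rfl⟩ := heq
      rw [YoungDiagram.mem_cells, YoungDiagram.mem_iff_lt_rowLen] at hxy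
      simpa using hxy
    · rintro ⟨h2, h3, h4⟩
      exact ⟨(r - a, c - b), (YoungDiagram.mem_cells _).mpr (YoungDiagram.mem_iff_lt_rowLen.mpr h4),
        by simp only [Prod.mk.injEq]; omega⟩
  have h0 := rowLen_mono hη r
  have k1 := key (η.rowLen r)
  have k2 := key (ν.rowLen r - 1)
  have k3 := key (ν.rowLen r)
  have k4 := key b
  have k5 := key (b + ρ.rowLen (r - a) - 1)
  have k6 := key (b + ρ.rowLen (r - a))
  split_ifs <;> omega

/-- Adding a cell in the first `s` rows of `β + (s^s) + α` never gives a cover. -/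
theorem not_covers_of_row_lt {β α : YoungDiagram} {s : ℕ} (hν : ν = β + square s + α)
    (hm : μ.rowLen 0 + μ.colLen 0 ≤ m) {k : ℕ} (hk : k < s)
    (hμ : ∀ r, μ.rowLen r = ν.rowLen r + if r = k then 1 else 0) : ¬ Covers m μ ν := by
  intro hcov
  have hrow : ∀ r, ν.rowLen r = (β + α).rowLen r + if r < s then s else 0 := by
    intro r
    rw [hν, rowLen_add, rowLen_add, rowLen_add, rowLen_square]
    omega
  have hext : IsSelfConjugateExtension ν (β + α) (square s) 0 :=
    ⟨transpose_square s, fun r => by rw [hrow, rowLen_square]; simp⟩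
  have hνm : ν.rowLen 0 + ν.colLen 0 ≤ m :=
    (Nat.add_le_add (rowLen_mono hcov.le 0) (colLen_mono hcov.le 0)).trans hm
  obtain ⟨T, hT⟩ := hext.exists_contributes_of_covers hνm hcov
  have hη : β + α ≤ μ := by
    rintro ⟨r, c⟩ hc
    have hc' := YoungDiagram.mem_iff_lt_rowLen.mp hc
    refine YoungDiagram.mem_iff_lt_rowLen.mpr ?_
    have := hμ r
    have := hrow r
    omega
  have h1 := hT.rowLen_le_add hm hη (s := s) (fun r hr => by
    rw [hμ, hrow, if_neg (by omega), if_neg (by omega), Nat.add_zero]) k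
  have h2 := hμ k
  have h3 := hrow k
  rw [if_pos rfl] at h2
  rw [if_pos hk] at h3
  omega

/-- Adding a cell below the first `s + 1` rows never gives a cover if the partition without its first
`s` rows is corner-symmetric. -/
theorem not_covers_of_lt_row {s : ℕ} (hsym : CornerSymmetric (dropRows s ν))
    (hm : μ.rowLen 0 + μ.colLen 0 ≤ m) {c : ℕ × ℕ} (hc : c ∉ ν)
    (hμ : μ.cells = insert c ν.cells) (hs : s < c.1) : ¬ Covers m μ ν := by
  intro hcov
  have hrowμ := rowLen_of_cells_eq_insert hc hμ
  have hc2 := snd_of_cells_eq_insert hc hμ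
  obtain ⟨k, j⟩ := c
  dsimp only at hs hrowμ hc2
  obtain ⟨η', -, hη', ⟨ρ, a, b, hρ, hdiff⟩, hmem, hcols⟩ :=
    hsym (k - s) j (by omega) (isOuterCorner_dropRows hc hμ hs.le)
  have hrows := rowLen_of_isSelfConjugateShape hdiff hη'
  simp only [rowLen_dropRows] at hrows
  -- the top left cell of the self-conjugate shape lies in column `j`
  rw [hdiff, mem_image] at hmem
  obtain ⟨⟨x, y⟩, hxy, heq⟩ := hmem
  simp only [Prod.mk.injEq] at heq
  rw [YoungDiagram.mem_cells] at hxy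
  have hjb : j = b := by
    have := hcols (0 + a, 0 + b) (by
      rw [hdiff]
      exact mem_image_of_mem _ (ρ.up_left_mem (Nat.zero_le x) (Nat.zero_le y) hxy))
    dsimp only at this
    omega
  have hx0 : x < ρ.colLen 0 :=
    YoungDiagram.mem_iff_lt_colLen.mp (ρ.up_left_mem le_rfl (Nat.zero_le y) hxy)
  let η : YoungDiagram := ofRows (fun r => if r < s then ν.rowLen r else η'.rowLen (r - s))
    (by
      intro r r' hr
      have e1 := ν.rowLen_anti r r' hr
      have e2 := η'.rowLen_anti (r - s) (r' - s) (by omega)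
      have e3 := rowLen_mono hη' (r' - s)
      rw [rowLen_dropRows] at e3
      dsimp only
      split_ifs with h1 h2
      · exact e1
      · omega
      · rw [Nat.sub_add_cancel (by omega)] at e3
        omega
      · exact e2)
    (ν.colLen 0 + s)
    (by
      have e3 := rowLen_mono hη' (ν.colLen 0)
      rw [rowLen_dropRows, rowLen_eq_zero ν (Nat.le_add_right _ _)] at e3
      rw [if_neg (by omega), Nat.add_sub_cancel]
      omega)
  have hηrow : ∀ r, η.rowLen r = if r < s then ν.rowLen r else η'.rowLen (r - s) :=
    fun r => rowLen_ofRows r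
  have hext : IsSelfConjugateExtension ν η ρ (s + a) := by
    refine ⟨hρ, fun r => ?_⟩
    rw [hηrow]
    by_cases h1 : r < s
    · rw [if_pos h1, if_pos (by omega), Nat.add_zero]
    · have e1 := (hrows (r - s)).1
      rw [Nat.sub_add_cancel (by omega), Nat.sub_sub] at e1
      rw [if_neg h1, e1]
      congr 1
      exact if_congr (by omega) rfl rfl
  have hρlen : ρ.rowLen 0 = ρ.colLen 0 := by
    conv_lhs => rw [← hρ]
    exact YoungDiagram.rowLen_transpose ρ 0
  have hηb : ∀ r, s + a ≤ r → 0 < ρ.rowLen (r - (s + a)) → η.rowLen r = b := by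
    intro r hr h0
    rw [hηrow, if_neg (by omega)]
    exact (hrows (r - s)).2 (by omega) (by rwa [Nat.sub_sub])
  -- row `k` meets no cell of the self-conjugate shape, which therefore has `k - (s + a)` rows
  have hk0 : ρ.rowLen (k - (s + a)) = 0 := by
    by_contra hne
    have e1 := hηb k (by omega) (Nat.pos_of_ne_zero hne)
    have e2 := hext.rowLen_eq k
    rw [if_neg (by omega)] at e2
    omega
  have hlen : ρ.colLen 0 = k - (s + a) := by
    have : ¬ k - (s + a) < ρ.colLen 0 := fun hlt => by
      rw [← rowLen_pos_iff] at hlt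
      omega
    omega
  have hνm : ν.rowLen 0 + ν.colLen 0 ≤ m :=
    (Nat.add_le_add (rowLen_mono hcov.le 0) (colLen_mono hcov.le 0)).trans hm
  obtain ⟨T, hT⟩ := hext.exists_contributes_of_covers hνm hcov
  have hη : η ≤ μ := by
    rintro ⟨r, c⟩ hc
    have hc' := YoungDiagram.mem_iff_lt_rowLen.mp hc
    refine YoungDiagram.mem_iff_lt_rowLen.mpr ?_
    have e1 := hext.rowLen_le r
    have e2 := rowLen_mono hcov.le r
    omega
  have hηk : η.rowLen k = b := by
    have e1 := hext.rowLen_eq k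
    rw [if_neg (by omega)] at e1
    omega
  refine hT.not_cell_below hm hη (a := s + a) (b := b) (k := k) (by omega) ?_ ?_ ?_ ?_ ?_
  · intro r h1 h2
    rcases Nat.eq_or_lt_of_le h2 with h3 | h3
    · rw [h3, hηk]
    · exact hηb r h1 (rowLen_pos_iff.mpr (by omega))
  · intro r hr
    rw [hrowμ, if_neg (by omega), hext.rowLen_eq, if_pos hr]
    rfl
  · intro r hr
    have e1 : ρ.rowLen (r - (s + a)) = 0 := rowLen_eq_zero ρ (by omega)
    rw [hrowμ, if_neg (by omega), hext.rowLen_eq, if_neg (by omega), e1]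
    rfl
  · rw [hrowμ, if_neg (by omega), hext.rowLen_eq, if_neg (lt_irrefl _), Nat.sub_self, hρlen, hlen,
      hηb (s + a) le_rfl (by rw [Nat.sub_self]; exact rowLen_pos_iff.mpr (by omega)), Nat.add_zero]
  · rw [hrowμ, if_pos rfl]
    omega

theorem not_covers_of_cornerSymmetric {β α : YoungDiagram} {s : ℕ} (hν : ν = β + square s + α)
    (hsym : CornerSymmetric (dropRows s ν)) (hle : ν ≤ μ) (hcard : μ.card = ν.card + 1)
    (hne : μ ≠ β + squareOne s + α) (hm : μ.rowLen 0 + μ.colLen 0 ≤ m) : ¬ Covers m μ ν := by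
  obtain ⟨c, hc, hμ⟩ := exists_cells_eq_insert hle hcard
  have hrow := rowLen_of_cells_eq_insert hc hμ
  rcases lt_trichotomy c.1 s with hlt | heq | hgt
  · exact not_covers_of_row_lt hν hm hlt hrow
  · refine absurd (ext_rowLen fun r => ?_) hne
    have hsq : (squareOne s).rowLen r = if r < s then s else if r = s then 1 else 0 :=
      rowLen_ofRows r
    rw [hrow, hν, rowLen_add, rowLen_add, rowLen_add, rowLen_add, rowLen_square, hsq, heq]
    split_ifs <;> omega
  · exact not_covers_of_lt_row hsym hm hc hμ hgt

/-- A single column of length at least two is corner-symmetric: its last cell is a self-conjugate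
shape. -/
theorem cornerSymmetric_of_column (hν : ∀ r, ν.rowLen r ≤ 1) (h1 : ν.rowLen 1 = 1) :
    CornerSymmetric ν := by
  intro k j hk hcorner
  have hkj : (k - 1, j) ∈ ν := by
    have h2 : (k - 1, j) ∈ insert (k, j) (ν.cells : Set (ℕ × ℕ)) :=
      hcorner.2 (show ((k - 1, j) : ℕ × ℕ) ≤ (k, j) from ⟨Nat.sub_le k 1, le_rfl⟩)
        (Set.mem_insert _ _)
    rcases h2 with h2 | h2
    · rw [Prod.ext_iff] at h2
      exact absurd h2.1 (by dsimp only; omega)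
    · exact h2
  have hkj' := YoungDiagram.mem_iff_lt_rowLen.mp hkj
  have hb := hν (k - 1)
  have hj : j = 0 := by omega
  subst hj
  have hk0 : ν.rowLen k = 0 := by
    by_contra hne
    exact hcorner.1 (YoungDiagram.mem_iff_lt_rowLen.mpr (Nat.pos_of_ne_zero hne))
  have hk2 : 1 < k := by
    by_contra hle
    have : k = 1 := by omega
    rw [this] at hk0
    omega
  let η : YoungDiagram := ofRows (fun r => if r < k - 1 then 1 else 0)
    (by intro r r' hr; dsimp only; split_ifs <;> omega) (k - 1) (by simp)
  have hη : ∀ c, c ∈ η ↔ c.2 < if c.1 < k - 1 then 1 else 0 := fun c => mem_ofRows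
  have hrow : ∀ r, ν.rowLen r = if r < k then 1 else 0 := by
    intro r
    split_ifs with hr
    · have e1 := ν.rowLen_anti r (k - 1) (by omega)
      have e2 := hν r
      omega
    · have := ν.rowLen_anti k r (by omega)
      omega
  have hdiff : ∀ c, c ∈ ν.cells \ η.cells ↔ c = (k - 1, 0) := by
    rintro ⟨r, c⟩
    rw [mem_sdiff, YoungDiagram.mem_cells, YoungDiagram.mem_cells, hη,
      YoungDiagram.mem_iff_lt_rowLen, hrow, Prod.ext_iff]
    dsimp only
    split_ifs <;> omega
  refine ⟨η, ?_, ?_, ⟨square 1, k - 1, 0, transpose_square 1, ?_⟩, (hdiff _).mpr rfl,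
    fun c _ => Nat.zero_le _⟩
  · intro hbot
    have h3 : ((0, 0) : ℕ × ℕ) ∈ η := (hη _).mpr (by rw [if_pos (by omega)]; exact one_pos)
    rw [hbot] at h3
    exact YoungDiagram.notMem_bot _ h3
  · rintro ⟨r, c⟩ hc
    rw [hη] at hc
    rw [YoungDiagram.mem_iff_lt_rowLen, hrow]
    dsimp only at hc
    split_ifs at hc ⊢ <;> omega
  · ext c
    rw [hdiff, mem_image]
    constructor
    · rintro rfl
      refine ⟨(0, 0), ?_, by simp⟩
      rw [YoungDiagram.mem_cells, YoungDiagram.mem_iff_lt_rowLen, rowLen_square]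
      simp
    · rintro ⟨⟨x, y⟩, hxy, rfl⟩
      rw [YoungDiagram.mem_cells, YoungDiagram.mem_iff_lt_rowLen, rowLen_square] at hxy
      rw [Prod.ext_iff]
      dsimp only
      split_ifs at hxy <;> omega

theorem IsTypeTwo.cornerSymmetric_dropRows {β α : YoungDiagram} {s : ℕ} (h : IsTypeTwo β s α)
    (hβ : β.rowLen 0 = 1) : CornerSymmetric (dropRows s (β + square s + α)) := by
  have hrow : ∀ r, (dropRows s (β + square s + α)).rowLen r = β.rowLen (r + s) := by
    intro r
    have hα := rowLen_eq_zero α (h.length_le.trans (Nat.le_add_left s r))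
    rw [rowLen_dropRows, rowLen_add, rowLen_add, rowLen_square, hα, if_neg (by omega)]
    rfl
  refine cornerSymmetric_of_column (fun r => ?_) ?_
  · rw [hrow, ← hβ]
    exact β.rowLen_anti 0 _ (Nat.zero_le _)
  · have e1 := rowLen_mono h.contains (1 + s)
    have e2 : (fatStaircase (β.rowLen 0) s).rowLen (1 + s)
        = β.rowLen 0 - (1 + s - (s + 1)) := rowLen_ofRows _
    have e3 := β.rowLen_anti 0 (1 + s) (Nat.zero_le _)
    rw [hrow]
    omega

end Covering

end SchurCover

theorem mainTheorem7 (β α ν : YoungDiagram) (s : ℕ)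
    (htype : SchurCover.IsTypeTwo β s α)
    (hν : ν = β + SchurCover.square s + α) :
    (SchurCover.CornerSymmetric (SchurCover.dropRows s ν) →
      ∀ μ : YoungDiagram, ν ≤ μ → μ.card = ν.card + 1 →
        μ ≠ β + SchurCover.squareOne s + α →
        ∀ m : ℕ, μ.rowLen 0 + μ.colLen 0 ≤ m → ¬ SchurCover.Covers m μ ν) ∧
    (β.rowLen 0 = 1 →
      ∀ μ : YoungDiagram, ν ≤ μ → μ.card = ν.card + 1 →
        μ ≠ β + SchurCover.squareOne s + α →
        ∀ m : ℕ, μ.rowLen 0 + μ.colLen 0 ≤ m → ¬ SchurCover.Covers m μ ν) :=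
  ⟨fun hsym _ hle hcard hne _ hm =>
    SchurCover.not_covers_of_cornerSymmetric hν hsym hle hcard hne hm,
  fun hβ _ hle hcard hne _ hm => SchurCover.not_covers_of_cornerSymmetric hν
    (hν ▸ htype.cornerSymmetric_dropRows hβ) hle hcard hne hm⟩
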